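/- Let $\mathcal A$ be a separable $C^*$-algebra with multiplier algebra $M(\mathcal A)$, let $T$ be a locally compact metric space with a Radon measure $\mu$, and extend each bounded functional $\varphi$ on $\mathcal A$ canonically (strictly continuously on bounded sets) to $M(\mathcal A)$. A field $(a_t)_{t\in T}$ in $M(\mathcal A)$ is weak* measurable if $t\mapsto\varphi(a_t)$ is $\mu$-measurable for every $\varphi\in\mathcal A^*$. A field $(c_t)_{t\in T}$ in $M(\mathcal A)$ is integrable, with integral $\int_T c_t\,d\mu(t)=c\in M(\mathcal A)$, if $t\mapsto \varphi(c_t)$ is $\mu$-integrable with $\int_T\varphi(c_t)\,d\mu(t)=\varphi(c)$ for every $\varphi\in\mathcal A^*$. Let $\mathcal A_1,\dots,\mathcal A_n$ be mutually commuting $C^*$-subalgebras of $\mathcal A$. Let $M(\mathcal A_i)$ denote the set of those $m\in M(\mathcal A)$ with $m\mathcal A_i+\mathcal A_i m\subset\mathcal A_i$ that commute with every element of $M(\mathcal A)$ commuting with $\mathcal A_i$ (the last condition is automatic if $\mathcal A_i\mathcal A$ spans a dense subspace of $\mathcal A$). Let $I_1,\dots,I_n\subset\mathbb R$ be intervals and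 $f\colon I_1\times\cdots\times I_n\to\mathbb R$ a convex, continuous function. Let $x_i\in\mathcal A_i$ be self-adjoint with spectrum (in $M(\mathcal A)$) contained in $I_i$, for $1\le i\le n$. For each $i$ let $(a_{it})_{t\in T}$ be a weak* measurable field in $M(\mathcal A_i)$ such that $(a_{it}^*a_{it})_{t\in T}$ is integrable, put $b_i=\int_T a_{it}^*a_{it}\,d\mu(t)$, and assume $\sum_{i=1}^n b_i=\mathbf 1$. Then the fields $(a_{it}^*x_ia_{it})_{t\in T}$ and $(a_{it}^*f(x_1,\dots,x_n)a_{it})_{t\in T}$ are integrable; the elements $$y_i=\int_T a_{it}^*x_ia_{it}\,d\mu(t)+(\mathbf 1-b_i)x_i\qquad(1\le i\le n)$$ are self-adjoint, commute with one another, and have spectra in $I_i$; and $$\varphi\bigl(f(y_1,\dots,y_n)\bigr)\le\varphi\Bigl(\sum_{i=1}^n\int_T a_{it}^*f(x_1,\dots,x_n)a_{it}\,d\mu(t)\Bigr)$$ for every positive functional $\varphi$ on $\mathcal A$ that contains $y_1,\dots,y_n$ in its centralizer $\{y\in\mathcal A\mid \varphi(xy)=\varphi(yx)\text{ for all }x\in\mathcal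 A\}$. Here $f(x_1,\dots,x_n)$ and $f(y_1,\dots,y_n)$ are formed in $M(\mathcal A)$ by the joint continuous functional calculus of commuting self-adjoint elements. -/

import Mathlib

open MeasureTheory Filter Topology
open scoped MultiplierAlgebra ComplexOrder

namespace TraceJensen

section JointCalculus

variable {M : Type*} [CStarAlgebra M] {n : ℕ}

/-- An abelian `n`-tuple: pairwise commuting self-adjoint elements. -/
def IsAbelianTuple (x : Fin n → M) : Prop :=
  (∀ i, IsSelfAdjoint (x i)) ∧ ∀ i j, Commute (x i) (x j)

/-- The product `sp(x₁) × ⋯ × sp(xₙ) ⊆ ℝⁿ` of the spectra. -/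
def spectralBox (x : Fin n → M) : Set (Fin n → ℝ) :=
  Set.univ.pi fun i => spectrum ℝ (x i)

/-- The coordinate function `λ ↦ λᵢ` on the product of the spectra. -/
noncomputable def boxCoord (x : Fin n → M) (i : Fin n) : C(spectralBox x, ℂ) :=
  ⟨fun l => ((l.1 i : ℝ) : ℂ),
    Complex.continuous_ofReal.comp ((continuous_apply i).comp continuous_subtype_val)⟩

instance (x : Fin n → M) : CompactSpace (spectralBox x) :=
  isCompact_iff_compactSpace.mp
    (isCompact_univ_pi fun i => (spectrum.isCompact (𝕜 := ℝ) (x i)))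

/-- A unital `*`-homomorphism `C(sp(x₁) × ⋯ × sp(xₙ)) → M` taking the `i`-th coordinate function to
`xᵢ`. By Stone-Weierstrass there is at most one (such maps are norm continuous). -/
def IsJointCalculus (x : Fin n → M) (Φ : C(spectralBox x, ℂ) →⋆ₐ[ℂ] M) : Prop :=
  ∀ i, Φ (boxCoord x i) = x i

open WeakDual StarAlgebra StarSubalgebra in
/-- Every abelian tuple has a joint functional calculus. -/
theorem exists_isJointCalculus (x : Fin n → M) (hx : IsAbelianTuple x) :
    ∃ Φ : C(spectralBox x, ℂ) →⋆ₐ[ℂ] M, IsJointCalculus x Φ := by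
  let S : StarSubalgebra ℂ M := (adjoin ℂ (Set.range x)).topologicalClosure
  have hS : IsClosed (S : Set M) := (adjoin ℂ (Set.range x)).isClosed_topologicalClosure
  have hcomm : IsMulCommutative (adjoin ℂ (Set.range x)) := by
    refine isMulCommutative_adjoin ℂ ?_ ?_
    · rintro _ ⟨i, rfl⟩ _ ⟨j, rfl⟩
      exact hx.2 i j
    · rintro _ ⟨i, rfl⟩ _ ⟨j, rfl⟩
      rw [(hx.1 j).star_eq]
      exact hx.2 i j
  let _ : CommRing S := (adjoin ℂ (Set.range x)).commRingTopologicalClosure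
    fun u v => Subtype.ext (setLike_mul_comm u.2 v.2)
  let _ : CommCStarAlgebra S := { }
  let X : Fin n → S := fun i => ⟨x i, le_topologicalClosure _ (subset_adjoin ℂ _ ⟨i, rfl⟩)⟩
  have hXsa : ∀ i, IsSelfAdjoint (X i) := fun i => Subtype.ext (hx.1 i).star_eq
  have hval : ∀ (χ : characterSpace ℂ S) i, ((χ (X i)).re : ℂ) = χ (X i) := fun χ i =>
    Complex.conj_eq_iff_re.mp ((map_star χ (X i)).symm.trans (by rw [(hXsa i).star_eq]))
  have hmem : ∀ (χ : characterSpace ℂ S) i, (χ (X i)).re ∈ spectrum ℝ (x i) := by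
    intro χ i
    have h1 : χ (X i) ∈ spectrum ℂ (X i) := AlgHom.apply_mem_spectrum χ (X i)
    have h2 : χ (X i) ∈ spectrum ℂ (x i) := by
      rw [@StarSubalgebra.spectrum_eq _ _ S hS] at h1
      exact h1
    rw [← hval] at h2
    exact spectrum.of_algebraMap_mem (S := ℂ) h2
  let g : C(characterSpace ℂ S, spectralBox x) :=
    ⟨fun χ => ⟨fun i => (χ (X i)).re, fun i _ => hmem χ i⟩, by
      refine Continuous.subtype_mk (continuous_pi fun i => Complex.continuous_re.comp ?_) _
      exact (gelfandTransform ℂ S (X i)).continuous⟩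
  refine ⟨S.subtype.comp (((gelfandStarTransform S).symm : C(characterSpace ℂ S, ℂ) →⋆ₐ[ℂ] S).comp
    (ContinuousMap.compStarAlgHom' ℂ ℂ g)), fun i => ?_⟩
  have : ContinuousMap.compStarAlgHom' ℂ ℂ g (boxCoord x i) = gelfandStarTransform S (X i) := by
    ext χ
    exact hval χ i
  change ((gelfandStarTransform S).symm (ContinuousMap.compStarAlgHom' ℂ ℂ g (boxCoord x i)) : M) = x i
  rw [this, StarAlgEquiv.symm_apply_apply]

/-- At most one joint functional calculus exists. -/
theorem IsJointCalculus.unique (x : Fin n → M) {Φ Ψ : C(spectralBox x, ℂ) →⋆ₐ[ℂ] M}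
    (hΦ : IsJointCalculus x Φ) (hΨ : IsJointCalculus x Ψ) : Φ = Ψ := by
  have htop : (StarAlgebra.adjoin ℂ (Set.range (boxCoord x))).topologicalClosure = ⊤ := by
    apply ContinuousMap.starSubalgebra_topologicalClosure_eq_top_of_separatesPoints
    intro p q hpq
    have : ∃ i, p.1 i ≠ q.1 i := by
      by_contra! h
      exact hpq (Subtype.ext (funext h))
    obtain ⟨i, hi⟩ := this
    refine ⟨_, ⟨boxCoord x i, StarAlgebra.subset_adjoin ℂ _ ⟨i, rfl⟩, rfl⟩, ?_⟩
    simpa [boxCoord] using hi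
  have hcl : IsClosed ((StarAlgHom.equalizer Φ Ψ : StarSubalgebra ℂ _) : Set C(spectralBox x, ℂ)) :=
    isClosed_eq (NonUnitalStarAlgHom.instContinuousLinearMapClassComplex.map_continuous Φ)
      (NonUnitalStarAlgHom.instContinuousLinearMapClassComplex.map_continuous Ψ)
  have hle : (⊤ : StarSubalgebra ℂ C(spectralBox x, ℂ)) ≤ StarAlgHom.equalizer Φ Ψ := by
    rw [← htop]
    refine StarSubalgebra.topologicalClosure_minimal (StarAlgebra.adjoin_le ?_) hcl
    rintro _ ⟨i, rfl⟩
    exact (hΦ i).trans (hΨ i).symm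
  exact StarAlgHom.ext fun g => hle (StarSubalgebra.mem_top (x := g))

open Classical in
/-- `f(x)` for a real function `f` that is continuous on the product of the spectra of the abelian
tuple `x`. -/
noncomputable def jointCFC (f : (Fin n → ℝ) → ℝ) (x : Fin n → M) : M :=
  if h : (∃ Φ : C(spectralBox x, ℂ) →⋆ₐ[ℂ] M, IsJointCalculus x Φ) ∧
      ContinuousOn f (spectralBox x) then
    h.1.choose ⟨fun l => ((f l.1 : ℝ) : ℂ),
      Complex.continuous_ofReal.comp (continuousOn_iff_continuous_domRestrict.mp h.2)⟩
  else 0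

end JointCalculus

section Multipliers

variable {A : Type*} [NonUnitalCStarAlgebra A]

/-- `M(B)` inside `M(A)`, for a C⋆-subalgebra `B` of `A`: the multipliers `m` of `A` such that
`m B + B m ⊆ B` and `m` commutes with each multiplier of `A` that commutes with `B`. The second
clause is automatic if `B A` is dense in `A`, see `mem_multipliers_iff`. If it is not dense, then
the clause excludes the multipliers that do not come from `B` but, say, live on a complementary
summand of `A`. -/
def multipliers (B : NonUnitalStarSubalgebra ℂ A) : Set 𝓜(ℂ, A) :=
  {m | (∀ c ∈ B, m.fst c ∈ B ∧ m.snd c ∈ B) ∧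
    ∀ z : 𝓜(ℂ, A), (∀ c ∈ B, z * (c : 𝓜(ℂ, A)) = (c : 𝓜(ℂ, A)) * z) → m * z = z * m}

/-- For nondegenerate `B ⊆ A`, `multipliers B` is the idealizer of `B` in `M(A)`. -/
theorem mem_multipliers_iff (B : NonUnitalStarSubalgebra ℂ A)
    (hB : Dense (Submodule.span ℂ {y : A | ∃ c ∈ B, ∃ d, y = c * d} : Set A)) (m : 𝓜(ℂ, A)) :
    m ∈ multipliers B ↔ ∀ c ∈ B, m.fst c ∈ B ∧ m.snd c ∈ B := by
  refine ⟨fun h => h.1, fun h => ⟨h, fun z hz => ?_⟩⟩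
  have hz' : ∀ c ∈ B, ∀ d, z.fst (c * d) = c * z.fst d := fun c hc d => by
    simpa using congr(($(hz c hc)).fst d)
  have hm : ∀ w : 𝓜(ℂ, A), ∀ c d : A, w.fst (c * d) = w.fst c * d := fun w c d => by
    have h0 : star (w.fst (c * d) - w.fst c * d) * (w.fst (c * d) - w.fst c * d) = 0 := by
      rw [mul_sub, ← mul_assoc _ (w.fst c), ← w.central, ← w.central, mul_assoc, sub_self]
    exact sub_eq_zero.mp (CStarRing.star_mul_self_eq_zero_iff _ |>.mp h0)
  have key : (m * z).fst = (z * m).fst := by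
    refine ContinuousLinearMap.ext_on hB ?_
    rintro _ ⟨c, hc, d, rfl⟩
    simp only [DoubleCentralizer.mul_fst, mul_apply_eq_comp]
    rw [hz' c hc, hm m c, hm m c d, hz' _ (h c hc).1]
  have : ‖m * z - z * m‖ = 0 := by
    rw [← DoubleCentralizer.norm_fst, DoubleCentralizer.sub_fst, key, sub_self, norm_zero]
  exact sub_eq_zero.mp (norm_eq_zero.mp this)

end Multipliers

section Integrals

variable {A : Type*} [NonUnitalCStarAlgebra A] [PartialOrder A] [StarOrderedRing A]

/-- The canonical extension to `M(A)` of a bounded functional `φ` on `A`: the limit of `φ(m e)`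
along the approximate unit of `A`. -/
noncomputable def extend (φ : A → ℂ) (m : 𝓜(ℂ, A)) : ℂ :=
  limUnder (CStarAlgebra.approximateUnit A) fun e : A => φ (m.fst e)

theorem extend_coe (φ : A →ₚ[ℂ] ℂ) (a : A) : extend φ (a : 𝓜(ℂ, A)) = φ a := by
  refine Tendsto.limUnder_eq ?_
  have h : Tendsto (fun e : A => a * e) (CStarAlgebra.approximateUnit A) (𝓝 a) :=
    (CStarAlgebra.increasingApproximateUnit A).tendsto_mul_left a
  exact ((map_continuous φ).tendsto a).comp h

/-- The centralizer `A^φ`. -/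
def centralizer (φ : A →ₚ[ℂ] ℂ) : Set A := {y | ∀ x : A, φ (x * y) = φ (y * x)}

variable {T : Type*} [MeasurableSpace T]

/-- A field `(aₜ)` in `M(A)` is weak* measurable if `t ↦ φ(aₜ)` is `μ`-measurable for each `φ` in
the dual of `A`. -/
def WeakStarMeasurable (μ : Measure T) (a : T → 𝓜(ℂ, A)) : Prop :=
  ∀ φ : StrongDual ℂ A, AEStronglyMeasurable (fun t => extend φ (a t)) μ

/-- `y ∈ M(A)` is the integral of the field `(aₜ)` in `M(A)`: each `t ↦ φ(aₜ)` is integrable with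
integral `φ(y)`. Here `φ` runs through the positive functionals, which span the dual of `A`. -/
def IsFieldIntegral (μ : Measure T) (a : T → 𝓜(ℂ, A)) (y : 𝓜(ℂ, A)) : Prop :=
  ∀ φ : A →ₚ[ℂ] ℂ, Integrable (fun t => extend φ (a t)) μ ∧
    extend φ y = ∫ t, extend φ (a t) ∂μ

/-- The field `(aₜ)` has an integral in `M(A)`. -/
def FieldIntegrable (μ : Measure T) (a : T → 𝓜(ℂ, A)) : Prop :=
  ∃ y, IsFieldIntegral μ a y

open Classical in
/-- The integral `∫ aₜ dμ(t) ∈ M(A)` of an integrable field. -/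
noncomputable def fieldIntegral (μ : Measure T) (a : T → 𝓜(ℂ, A)) : 𝓜(ℂ, A) :=
  if h : FieldIntegrable μ a then h.choose else 0

end Integrals

end TraceJensen

/-!
The columns `a₁, …, aₙ` define a unital positive map `E h = ∑ⱼ ∫ aⱼₜ⋆ h aⱼₜ dμ(t)`. Everything with
index `j ≠ i` commutes with `xᵢ`, so that `∫ aⱼₜ⋆ xᵢ aⱼₜ = bⱼ xᵢ` for `j ≠ i`, and as `∑ⱼ bⱼ = 1` this
says `E xᵢ = yᵢ`. Positivity of `E` bounds the spectra of the `yᵢ`, and the same commutation relations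
make them a commuting self-adjoint tuple.

The integrals exist in `M(A)`, not only in the bidual (`fieldIntegrable_conj`). Over a set of finite
measure on which the field is bounded, `aₜ⋆ x aₜ c` is strongly measurable by Pettis' theorem, and the
integral is a Bochner integral (`fieldIntegrable_of_bounded`). These partial integrals form an
increasing net if `x ≥ 0`. It is dominated by the net of the partial integrals of `‖x‖ aₜ⋆ aₜ`,
which converges strictly because it converges under every positive functional: this is a
noncommutative Dini theorem (`exists_norm_lt_of_antitone`), a consequence of the Hahn-Banach theorem.
So the partial integrals are strictly Cauchy (`fieldIntegrable_of_exhaustion`).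

For the inequality, each affine minorant `ℓ` of `f` satisfies `ℓ(y) = E (ℓ(x)) ≤ E (f(x)) = Z`. On the
compact product of the spectra of the `yᵢ`, convexity gives a finite partition of unity `p` and affine
minorants with `f ≤ ∑ p ℓ + ε`. Because the `yᵢ` lie in the centralizer of `φ`, the functional
`m ↦ φ (p(y) m)` is positive, whence `φ (p(y) ℓ(y)) ≤ φ (p(y) Z)`. Summation gives
`φ (f(y)) ≤ φ Z + ε ‖φ‖` (`apply_jointCFC_le`).
-/

namespace TraceJensen

/-! ### The multiplier algebra -/

section Multiplier

variable {A : Type*} [NonUnitalCStarAlgebra A]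

/-- The multiplier algebra carries the order whose positive elements are the `star k * k`. -/
noncomputable instance multiplierPartialOrder : PartialOrder 𝓜(ℂ, A) :=
  CStarAlgebra.spectralOrder _

instance multiplierStarOrderedRing : StarOrderedRing 𝓜(ℂ, A) :=
  CStarAlgebra.spectralOrderedRing _

lemma fst_mul (m : 𝓜(ℂ, A)) (a b : A) : m.fst (a * b) = m.fst a * b := by
  have h0 : star (m.fst (a * b) - m.fst a * b) * (m.fst (a * b) - m.fst a * b) = 0 := by
    rw [mul_sub, ← mul_assoc _ (m.fst a), ← m.central, ← m.central, mul_assoc, sub_self]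
  exact sub_eq_zero.mp (CStarRing.star_mul_self_eq_zero_iff _ |>.mp h0)

lemma mul_coe (m : 𝓜(ℂ, A)) (a : A) : m * (a : 𝓜(ℂ, A)) = ((m.fst a : A) : 𝓜(ℂ, A)) := by
  refine DoubleCentralizer.ext _ _ _ _ (Prod.ext ?_ ?_)
  · ext x
    simpa using fst_mul m a x
  · ext x
    simpa using m.central x a

lemma norm_coe (a : A) : ‖(a : 𝓜(ℂ, A))‖ = ‖a‖ := by
  rw [← DoubleCentralizer.norm_fst, DoubleCentralizer.coe_fst]
  exact ContinuousLinearMap.opNorm_mul_apply ℂ A a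

lemma coe_injective : Function.Injective (fun a : A => (a : 𝓜(ℂ, A))) := fun a b h => by
  have : ‖(DoubleCentralizer.coeHom (𝕜 := ℂ) (A := A)) (a - b)‖ = 0 := by
    rw [map_sub]
    exact norm_eq_zero.mpr (sub_eq_zero.mpr h)
  exact sub_eq_zero.mp (norm_eq_zero.mp ((norm_coe (a - b)).symm.trans this))

lemma coe_star (a : A) : ((star a : A) : 𝓜(ℂ, A)) = star (a : 𝓜(ℂ, A)) :=
  map_star (DoubleCentralizer.coeHom (𝕜 := ℂ) (A := A)) a

lemma coe_mul_eq (a b : A) : ((a * b : A) : 𝓜(ℂ, A)) = (a : 𝓜(ℂ, A)) * b :=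
  map_mul (DoubleCentralizer.coeHom (𝕜 := ℂ) (A := A)) a b

lemma coe_sub (a b : A) : ((a - b : A) : 𝓜(ℂ, A)) = (a : 𝓜(ℂ, A)) - b :=
  map_sub (DoubleCentralizer.coeHom (𝕜 := ℂ) (A := A)) a b

lemma coe_add (a b : A) : ((a + b : A) : 𝓜(ℂ, A)) = (a : 𝓜(ℂ, A)) + b :=
  map_add (DoubleCentralizer.coeHom (𝕜 := ℂ) (A := A)) a b

lemma coe_zero : ((0 : A) : 𝓜(ℂ, A)) = 0 :=
  map_zero (DoubleCentralizer.coeHom (𝕜 := ℂ) (A := A))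

lemma norm_fst_apply_le (m : 𝓜(ℂ, A)) (a : A) : ‖m.fst a‖ ≤ ‖m‖ * ‖a‖ :=
  (m.fst.le_opNorm a).trans_eq (by rw [DoubleCentralizer.norm_fst])

lemma ext_fst {m m' : 𝓜(ℂ, A)} (h : ∀ a, m.fst a = m'.fst a) : m = m' := by
  have : ‖m - m'‖ = 0 := by
    rw [← DoubleCentralizer.norm_fst, DoubleCentralizer.sub_fst, ContinuousLinearMap.ext h,
      sub_self, norm_zero]
  exact sub_eq_zero.mp (norm_eq_zero.mp this)

/-- The element `c⋆ m d` of `A`, for `m ∈ M(A)` and `c, d ∈ A`. -/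
noncomputable def corner (c : A) (m : 𝓜(ℂ, A)) (d : A) : A := star c * m.fst d

lemma coe_corner (c : A) (m : 𝓜(ℂ, A)) (d : A) :
    ((corner c m d : A) : 𝓜(ℂ, A)) = star (c : 𝓜(ℂ, A)) * m * d := by
  rw [corner, coe_mul_eq, coe_star, mul_assoc, ← mul_coe]

lemma corner_sub (c : A) (m m' : 𝓜(ℂ, A)) (d : A) :
    corner c (m - m') d = corner c m d - corner c m' d := by
  simp [corner, mul_sub]

lemma corner_add (c : A) (m m' : 𝓜(ℂ, A)) (d : A) :
    corner c (m + m') d = corner c m d + corner c m' d := by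
  simp [corner, mul_add]

lemma eq_zero_of_corner {m : 𝓜(ℂ, A)} (h : ∀ c d, corner c m d = 0) : m = 0 := by
  refine ext_fst fun a => ?_
  exact CStarRing.star_mul_self_eq_zero_iff _ |>.mp (h _ _)

/-- Polarization: a multiplier is determined by its diagonal corners. -/
lemma eq_zero_of_corner_self {m : 𝓜(ℂ, A)} (h : ∀ c, corner c m c = 0) : m = 0 := by
  refine eq_zero_of_corner fun c d => ?_
  have h1 := h (c + d)
  have h2 := h (c + Complex.I • d)
  have hc := h c
  have hd := h d
  simp only [corner, map_add, map_smul, star_add, star_smul, add_mul, mul_add, smul_mul_assoc,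
    mul_smul_comm] at h1 h2 hc hd ⊢
  rw [hc, hd] at h1 h2
  simp only [zero_add, add_zero, smul_zero, Complex.star_def, Complex.conj_I] at h1 h2
  have h3 : star d * m.fst c = - (star c * m.fst d) := eq_neg_of_add_eq_zero_left (by simpa using h1)
  rw [h3] at h2
  have h4 : (2 * Complex.I) • (star c * m.fst d) = 0 := by
    rw [← h2]; module
  exact (smul_eq_zero.mp h4).resolve_left (by simp)

lemma isSelfAdjoint_of_coe {a : A} (ha : IsSelfAdjoint (a : 𝓜(ℂ, A))) : IsSelfAdjoint a :=
  coe_injective (by simpa only [coe_star] using ha.star_eq)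

variable [PartialOrder A] [StarOrderedRing A]

lemma coe_nonneg {a : A} (ha : 0 ≤ a) : 0 ≤ (a : 𝓜(ℂ, A)) :=
  map_nonneg (DoubleCentralizer.coeHom (𝕜 := ℂ) (A := A)) ha

lemma eq_zero_of_cube_eq_zero {R : Type*} [NonUnitalCStarAlgebra R] {a : R} (hs : star a = a)
    (h : a * a * a = 0) : a = 0 := by
  have h1 : star (a * a) * (a * a) = 0 := by rw [star_mul, hs, ← mul_assoc, h, zero_mul]
  have h2 := CStarRing.star_mul_self_eq_zero_iff _ |>.mp h1
  exact CStarRing.star_mul_self_eq_zero_iff a |>.mp (by rw [hs]; exact h2)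

/-- The embedding of `A` into `M(A)` reflects positivity: the negative part `n` of `a` satisfies
`n a n = - n³`, and both sides have to vanish. -/
lemma nonneg_of_coe {a : A} (ha : 0 ≤ (a : 𝓜(ℂ, A))) : 0 ≤ a := by
  have hn0 := CFC.negPart_nonneg a
  have h1 : (0 : A) ≤ a⁻ * a⁻ * a⁻ := conjugate_nonneg_of_nonneg hn0 hn0
  have h2 : a⁻ * a * a⁻ = - (a⁻ * a⁻ * a⁻) := by
    have hsa : IsSelfAdjoint a := isSelfAdjoint_of_coe (.of_nonneg ha)
    nth_rw 2 [← CFC.posPart_sub_negPart a]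
    rw [mul_sub, CFC.negPart_mul_posPart]
    simp
  have h3 : 0 ≤ ((a⁻ * a * a⁻ : A) : 𝓜(ℂ, A)) := by
    rw [coe_mul_eq, coe_mul_eq]
    exact conjugate_nonneg_of_nonneg ha (coe_nonneg hn0)
  have h4 : ((a⁻ * a * a⁻ : A) : 𝓜(ℂ, A)) = 0 := by
    refine le_antisymm ?_ h3
    rw [h2, ← sub_nonneg, ← zero_sub, coe_sub, coe_zero]
    simpa using coe_nonneg h1
  have h5 : a⁻ * a⁻ * a⁻ = 0 := by
    have := coe_injective (h4.trans coe_zero.symm)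
    rwa [h2, neg_eq_zero] at this
  have hn : a⁻ = 0 := eq_zero_of_cube_eq_zero (IsSelfAdjoint.of_nonneg hn0).star_eq h5
  have hsa : IsSelfAdjoint a := isSelfAdjoint_of_coe (.of_nonneg ha)
  rw [← CFC.posPart_sub_negPart a, hn, sub_zero]
  exact CFC.posPart_nonneg a

lemma corner_nonneg {m : 𝓜(ℂ, A)} (hm : 0 ≤ m) (c : A) : 0 ≤ corner c m c :=
  nonneg_of_coe (by rw [coe_corner]; exact star_left_conjugate_nonneg hm _)

/-- A multiplier is positive if all its diagonal corners are. -/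
lemma nonneg_of_corner {m : 𝓜(ℂ, A)} (h : ∀ c : A, 0 ≤ corner c m c) : 0 ≤ m := by
  have hsa : IsSelfAdjoint m := by
    refine sub_eq_zero.mp (eq_zero_of_corner_self fun c => coe_injective ?_)
    have hc : star ((corner c m c : A) : 𝓜(ℂ, A)) = ((corner c m c : A) : 𝓜(ℂ, A)) :=
      (IsSelfAdjoint.of_nonneg (coe_nonneg (h c))).star_eq
    simp only [coe_corner, coe_zero] at hc ⊢
    simp only [star_mul, star_star, ← mul_assoc] at hc
    rw [mul_sub, sub_mul, hc, sub_self]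
  have hneg : m⁻ * m * m⁻ = - (m⁻ * m⁻ * m⁻) := by
    nth_rw 2 [← CFC.posPart_sub_negPart m]
    rw [mul_sub, CFC.negPart_mul_posPart]
    simp
  have hn0 := CFC.negPart_nonneg m
  have hs : star (m⁻) = m⁻ := (IsSelfAdjoint.of_nonneg hn0).star_eq
  have h3 : m⁻ * m⁻ * m⁻ = 0 := by
    refine eq_zero_of_corner_self fun c => ?_
    refine coe_injective (show _ = ((0 : A) : 𝓜(ℂ, A)) from ?_)
    rw [coe_zero]
    refine le_antisymm ?_ (coe_nonneg (corner_nonneg (conjugate_nonneg_of_nonneg hn0 hn0) c))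
    have h1 := coe_nonneg (h ((m⁻).fst c))
    rw [coe_corner, ← mul_coe, star_mul, hs] at h1
    have h2 : star (c : 𝓜(ℂ, A)) * m⁻ * m * (m⁻ * c) = - ((corner c (m⁻ * m⁻ * m⁻) c : A) : 𝓜(ℂ, A)) := by
      rw [coe_corner, ← neg_mul, ← mul_neg, ← hneg]
      simp only [mul_assoc]
    rw [h2] at h1
    exact neg_nonneg.mp h1
  have hn : m⁻ = 0 := eq_zero_of_cube_eq_zero hs h3
  rw [← CFC.posPart_sub_negPart m, hn, sub_zero]
  exact CFC.posPart_nonneg m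

end Multiplier

/-! ### Positive functionals -/

section PositiveFunctional

variable {A : Type*} [NonUnitalCStarAlgebra A] [PartialOrder A] [StarOrderedRing A]

/-- The Cauchy-Schwarz inequality for a positive functional. -/
lemma norm_sq_apply_star_mul_le (φ : A →ₚ[ℂ] ℂ) (a b : A) :
    ‖φ (star a * b)‖ ^ 2 ≤ (φ (star a * a)).re * (φ (star b * b)).re := by
  have h := norm_inner_le_norm (𝕜 := ℂ) (φ.toPreGNS a) (φ.toPreGNS b)
  rw [φ.preGNS_inner_def, φ.preGNS_norm_def, φ.preGNS_norm_def] at h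
  simp only [φ.ofPreGNS_toPreGNS] at h
  have ha : 0 ≤ (φ (star a * a)).re :=
    (Complex.nonneg_iff.mp (φ.map_nonneg (star_mul_self_nonneg a))).1
  have hb : 0 ≤ (φ (star b * b)).re :=
    (Complex.nonneg_iff.mp (φ.map_nonneg (star_mul_self_nonneg b))).1
  calc ‖φ (star a * b)‖ ^ 2 ≤ (√(φ (star a * a)).re * √(φ (star b * b)).re) ^ 2 := by gcongr
    _ = _ := by rw [mul_pow, Real.sq_sqrt ha, Real.sq_sqrt hb]

lemma norm_sq_apply_fst_le (φ : A →ₚ[ℂ] ℂ) {C : ℝ} (hC : ∀ a, ‖φ a‖ ≤ C * ‖a‖)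
    (w : 𝓜(ℂ, A)) {d : A} (hd : 0 ≤ d) :
    ‖φ (w.fst d)‖ ^ 2 ≤ C * (‖w‖ ^ 2 * ‖d‖) * (φ d).re := by
  have hs := CFC.sqrt_nonneg d
  have hss : CFC.sqrt d * CFC.sqrt d = d := CFC.sqrt_mul_sqrt_self d
  have hst : star (CFC.sqrt d) = CFC.sqrt d := (IsSelfAdjoint.of_nonneg hs).star_eq
  generalize CFC.sqrt d = s at hs hss hst
  have hns : ‖s‖ ^ 2 = ‖d‖ := by
    rw [← hss, sq, ← CStarRing.norm_star_mul_self, hst]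
  have hφd : 0 ≤ (φ d).re := (Complex.nonneg_iff.mp (φ.map_nonneg hd)).1
  have h := norm_sq_apply_star_mul_le φ (star (w.fst s)) s
  rw [star_star, hst, hss, ← fst_mul, hss] at h
  refine h.trans (mul_le_mul_of_nonneg_right ?_ hφd)
  refine (Complex.re_le_norm _).trans ((hC _).trans ?_)
  have hC0 : 0 ≤ C * ‖w.fst s * star (w.fst s)‖ := (norm_nonneg _).trans (hC _)
  rw [CStarRing.norm_self_mul_star] at hC0 ⊢
  rcases eq_or_ne ‖w.fst s‖ 0 with h0 | h0
  · rw [h0, mul_zero, mul_zero]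
    rcases le_or_gt 0 C with hC' | hC'
    · positivity
    · have h1 : ‖d‖ = 0 := by
        by_contra hne
        have := (norm_nonneg _).trans (hC d)
        have h2 : 0 < ‖d‖ := lt_of_le_of_ne (norm_nonneg _) (Ne.symm hne)
        nlinarith
      simp [h1]
  · have hC' : 0 ≤ C := nonneg_of_mul_nonneg_left hC0 (by positivity)
    refine mul_le_mul_of_nonneg_left ?_ hC'
    calc ‖w.fst s‖ * ‖w.fst s‖ ≤ (‖w‖ * ‖s‖) * (‖w‖ * ‖s‖) := by
          gcongr <;> exact norm_fst_apply_le w s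
      _ = ‖w‖ ^ 2 * ‖d‖ := by rw [← hns]; ring

/-- Along the approximate unit `e` the values `φ e` are almost constant. -/
lemma exists_apply_sub_le (φ : A →ₚ[ℂ] ℂ) {ε : ℝ} (hε : 0 < ε) :
    ∃ e₀ : A, 0 ≤ e₀ ∧ ‖e₀‖ < 1 ∧ ∀ e, e₀ ≤ e → ‖e‖ ≤ 1 → (φ (e - e₀)).re ≤ ε := by
  obtain ⟨C, hC⟩ := φ.exists_norm_apply_le
  let S : Set ℝ := (fun e => (φ e).re) '' {e : A | 0 ≤ e ∧ ‖e‖ < 1}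
  have hbdd : BddAbove S := by
    refine ⟨C, ?_⟩
    rintro _ ⟨e, ⟨-, he⟩, rfl⟩
    refine (Complex.re_le_norm _).trans ((hC e).trans ?_)
    exact mul_le_of_le_one_right C.2 he.le
  have hne : S.Nonempty := ⟨_, 0, by simp, rfl⟩
  obtain ⟨_, ⟨e₀, ⟨h0, h1⟩, rfl⟩, hlt⟩ := exists_lt_of_lt_csSup hne (sub_lt_self (sSup S) hε)
  refine ⟨e₀, h0, h1, fun e hle he => ?_⟩
  have hS0 : ∀ r : ℝ, 0 < r → r < 1 → r * (φ e).re ≤ sSup S := by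
    intro r hr0 hr1
    refine le_csSup hbdd ⟨r • e, ⟨smul_nonneg hr0.le (h0.trans hle), ?_⟩, ?_⟩
    · rw [norm_smul, Real.norm_of_nonneg hr0.le]
      nlinarith [norm_nonneg e]
    · simp
  have hS : (φ e).re ≤ sSup S := by
    have ht : Tendsto (fun r : ℝ => r * (φ e).re) (𝓝[<] 1) (𝓝 (1 * (φ e).re)) :=
      ((continuous_id.mul continuous_const).tendsto (1 : ℝ)).mono_left nhdsWithin_le_nhds
    rw [one_mul] at ht
    refine le_of_tendsto ht ?_
    filter_upwards [Ioo_mem_nhdsLT (zero_lt_one (α := ℝ))] with r hr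
    exact hS0 r hr.1 hr.2
  simp only [map_sub, Complex.sub_re] at hlt ⊢
  linarith

/-- The functionals `w ↦ φ (w e)` on `M(A)` are uniformly Cauchy along the approximate unit. -/
lemma exists_eventually_norm_sub_le (φ : A →ₚ[ℂ] ℂ) {ε : ℝ} (hε : 0 < ε) :
    ∃ e₀ : A, 0 ≤ e₀ ∧ ‖e₀‖ ≤ 1 ∧ ∀ᶠ e in CStarAlgebra.approximateUnit A,
      ∀ w : 𝓜(ℂ, A), ‖φ (w.fst e) - φ (w.fst e₀)‖ ≤ ε * ‖w‖ := by
  obtain ⟨C, hC⟩ := φ.exists_norm_apply_le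
  obtain ⟨e₀, h0, h1, h⟩ := exists_apply_sub_le φ (ε := ε ^ 2 / (C + 1)) (by positivity)
  refine ⟨e₀, h0, h1.le, ?_⟩
  filter_upwards [(CStarAlgebra.hasBasis_approximateUnit A).mem_of_mem ⟨h0, h1⟩] with e he w
  have hle : e₀ ≤ e := he.1
  have he1 : ‖e‖ ≤ 1 := by simpa using he.2
  have hd : 0 ≤ e - e₀ := sub_nonneg.mpr hle
  have hd1 : ‖e - e₀‖ ≤ 1 :=
    (CStarAlgebra.norm_le_norm_of_nonneg_of_le hd (sub_le_self e h0)).trans he1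
  rw [← map_sub, ← map_sub]
  refine abs_le_of_sq_le_sq' ?_ (by positivity) |>.2
  refine (norm_sq_apply_fst_le φ hC w hd).trans ?_
  calc (C : ℝ) * (‖w‖ ^ 2 * ‖e - e₀‖) * (φ (e - e₀)).re
      ≤ C * (‖w‖ ^ 2 * 1) * (ε ^ 2 / (C + 1)) := by
        refine mul_le_mul ?_ (h e hle he1) ?_ (by positivity)
        · gcongr
        · exact (Complex.nonneg_iff.mp (φ.map_nonneg hd)).1
    _ = (C / (C + 1)) * (ε * ‖w‖) ^ 2 := by ring
    _ ≤ 1 * (ε * ‖w‖) ^ 2 := by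
        gcongr
        rw [div_le_one (by positivity)]
        linarith
    _ = _ := one_mul _

lemma tendsto_extend (φ : A →ₚ[ℂ] ℂ) (m : 𝓜(ℂ, A)) :
    Tendsto (fun e : A => φ (m.fst e)) (CStarAlgebra.approximateUnit A) (𝓝 (extend φ m)) := by
  refine tendsto_nhds_limUnder (cauchy_map_iff_exists_tendsto.mp ?_)
  refine Metric.cauchy_iff.mpr ⟨inferInstance, fun ε hε => ?_⟩
  obtain ⟨e₀, -, -, h⟩ := exists_eventually_norm_sub_le φ (ε := ε / (3 * (‖m‖ + 1))) (by positivity)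
  refine ⟨_, image_mem_map h, ?_⟩
  rintro _ ⟨e, he, rfl⟩ _ ⟨e', he', rfl⟩
  have hb : ε / (3 * (‖m‖ + 1)) * ‖m‖ ≤ ε / 3 := by
    rw [div_mul_eq_mul_div, div_le_div_iff₀ (by positivity) (by positivity)]
    nlinarith [norm_nonneg m]
  have h1 := (he m).trans hb
  have h2 := (he' m).trans hb
  rw [dist_eq_norm]
  calc ‖φ (m.fst e) - φ (m.fst e')‖
      = ‖(φ (m.fst e) - φ (m.fst e₀)) - (φ (m.fst e') - φ (m.fst e₀))‖ := by congr 1; ring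
    _ ≤ ε / 3 + ε / 3 := (norm_sub_le _ _).trans (add_le_add h1 h2)
    _ < ε := by linarith

/-- The extension of a positive functional is a uniform limit of functionals `w ↦ φ (w e)`. -/
lemma exists_norm_extend_sub_le (φ : A →ₚ[ℂ] ℂ) {ε : ℝ} (hε : 0 < ε) :
    ∃ e₀ : A, 0 ≤ e₀ ∧ ‖e₀‖ ≤ 1 ∧ ∀ w : 𝓜(ℂ, A), ‖extend φ w - φ (w.fst e₀)‖ ≤ ε * ‖w‖ := by
  obtain ⟨e₀, h0, h1, h⟩ := exists_eventually_norm_sub_le φ hε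
  refine ⟨e₀, h0, h1, fun w => ?_⟩
  refine le_of_tendsto ((tendsto_extend φ w).sub_const _).norm ?_
  filter_upwards [h] with e he using he w

lemma extend_add (φ : A →ₚ[ℂ] ℂ) (m m' : 𝓜(ℂ, A)) :
    extend φ (m + m') = extend φ m + extend φ m' := by
  refine tendsto_nhds_unique (tendsto_extend φ (m + m')) ?_
  simpa using (tendsto_extend φ m).add (tendsto_extend φ m')

lemma extend_smul (φ : A →ₚ[ℂ] ℂ) (r : ℂ) (m : 𝓜(ℂ, A)) :
    extend φ (r • m) = r • extend φ m := by
  refine tendsto_nhds_unique (tendsto_extend φ (r • m)) ?_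
  simpa using (tendsto_extend φ m).const_smul r

lemma extend_nonneg (φ : A →ₚ[ℂ] ℂ) {m : 𝓜(ℂ, A)} (hm : 0 ≤ m) : 0 ≤ extend φ m := by
  have hcl : IsClosed {z : ℂ | 0 ≤ z} := isClosed_Ici
  refine hcl.closure_subset (Metric.mem_closure_iff.mpr fun ε hε => ?_)
  obtain ⟨e₀, h0, h1, h⟩ := exists_eventually_norm_sub_le φ (ε := ε / (3 * (‖m‖ + 1)))
    (by positivity)
  have hb : ε / (3 * (‖m‖ + 1)) * ‖m‖ ≤ ε / 3 := by
    rw [div_mul_eq_mul_div, div_le_div_iff₀ (by positivity) (by positivity)]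
    nlinarith [norm_nonneg m]
  have hlim : ‖extend φ m - φ (m.fst e₀)‖ ≤ ε / 3 := by
    refine le_of_tendsto ((tendsto_extend φ m).sub_const _).norm ?_
    filter_upwards [h] with e he using (he m).trans hb
  -- `φ (e m e₀)` is close to both `φ (m e₀)` and `φ (e m e) ≥ 0`
  have hl : Tendsto (fun e : A => φ (e * m.fst e₀)) (CStarAlgebra.approximateUnit A)
      (𝓝 (φ (m.fst e₀))) :=
    ((map_continuous φ).tendsto _).comp
      ((CStarAlgebra.increasingApproximateUnit A).tendsto_mul_right (m.fst e₀))
  have hl' : ∀ᶠ e in CStarAlgebra.approximateUnit A,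
      ‖φ (e * m.fst e₀) - φ (m.fst e₀)‖ < ε / 3 := by
    have := Metric.tendsto_nhds.mp hl (ε / 3) (by positivity)
    simpa [dist_eq_norm] using this
  obtain ⟨e, he1, he2, he3, he4⟩ := (hl'.and (h.and
    ((CStarAlgebra.increasingApproximateUnit A).eventually_nonneg.and
      (CStarAlgebra.increasingApproximateUnit A).eventually_norm))).exists
  have hfst : ∀ d : A, ((e : 𝓜(ℂ, A)) * m).fst d = e * m.fst d := fun d => by simp
  have h5 := he2 ((e : 𝓜(ℂ, A)) * m)
  rw [hfst, hfst] at h5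
  have h6 : ‖(e : 𝓜(ℂ, A)) * m‖ ≤ ‖m‖ := by
    refine (norm_mul_le _ _).trans ?_
    rw [norm_coe]
    exact mul_le_of_le_one_left (norm_nonneg _) he4
  have h7 : ‖φ (e * m.fst e) - φ (e * m.fst e₀)‖ ≤ ε / 3 :=
    h5.trans ((mul_le_mul_of_nonneg_left h6 (by positivity)).trans hb)
  have hpos : 0 ≤ φ (e * m.fst e) := by
    have h8 := corner_nonneg hm e
    rw [corner, (IsSelfAdjoint.of_nonneg he3).star_eq] at h8
    exact φ.map_nonneg h8
  refine ⟨φ (e * m.fst e), hpos, ?_⟩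
  rw [dist_eq_norm]
  calc ‖extend φ m - φ (e * m.fst e)‖
      = ‖(extend φ m - φ (m.fst e₀)) - (φ (e * m.fst e₀) - φ (m.fst e₀))
          - (φ (e * m.fst e) - φ (e * m.fst e₀))‖ := by congr 1; ring
    _ ≤ ‖extend φ m - φ (m.fst e₀)‖ + ‖φ (e * m.fst e₀) - φ (m.fst e₀)‖
          + ‖φ (e * m.fst e) - φ (e * m.fst e₀)‖ :=
        (norm_sub_le _ _).trans (add_le_add_left (norm_sub_le _ _) _)
    _ < ε := by linarith

/-- The canonical extension of a positive functional on `A` is a positive functional on `M(A)`. -/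
noncomputable def extendPositive (φ : A →ₚ[ℂ] ℂ) : 𝓜(ℂ, A) →ₚ[ℂ] ℂ :=
  PositiveLinearMap.mk₀
    { toFun := extend φ, map_add' := extend_add φ, map_smul' := extend_smul φ }
    fun _ hm => extend_nonneg φ hm

@[simp]
lemma extendPositive_apply (φ : A →ₚ[ℂ] ℂ) (m : 𝓜(ℂ, A)) : extendPositive φ m = extend φ m := rfl

/-- The canonical extension is strictly continuous on bounded sets. -/
lemma tendsto_extend_of_bounded (φ : A →ₚ[ℂ] ℂ) {ι : Type*} {l : Filter ι} {w : ι → 𝓜(ℂ, A)}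
    {w₀ : 𝓜(ℂ, A)} {K : ℝ} (hK : ∀ᶠ i in l, ‖w i‖ ≤ K)
    (h : ∀ a, Tendsto (fun i => (w i).fst a) l (𝓝 (w₀.fst a))) :
    Tendsto (fun i => extend φ (w i)) l (𝓝 (extend φ w₀)) := by
  refine Metric.tendsto_nhds.mpr fun ε hε => ?_
  set L : ℝ := |K| + ‖w₀‖ + 1 with hL
  have hL0 : 0 < L := by positivity
  obtain ⟨e, -, -, he⟩ := exists_norm_extend_sub_le φ (ε := ε / (3 * L)) (by positivity)
  have hb : ∀ m : 𝓜(ℂ, A), ‖m‖ ≤ L → ‖extend φ m - φ (m.fst e)‖ ≤ ε / 3 := fun m hm => by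
    refine (he m).trans ?_
    calc ε / (3 * L) * ‖m‖ ≤ ε / (3 * L) * L := by gcongr
      _ = ε / 3 := by field_simp
  have h1 := Metric.tendsto_nhds.mp (((map_continuous φ).tendsto _).comp (h e)) (ε / 3)
    (by positivity)
  filter_upwards [hK, h1] with i hi1 hi2
  have h3 := hb (w i) (by linarith [le_abs_self K, norm_nonneg w₀])
  have h4 := hb w₀ (by linarith [abs_nonneg K])
  rw [dist_eq_norm] at hi2 ⊢
  simp only [Function.comp] at hi2
  calc ‖extend φ (w i) - extend φ w₀‖
      = ‖(extend φ (w i) - φ ((w i).fst e)) + (φ ((w i).fst e) - φ (w₀.fst e))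
          - (extend φ w₀ - φ (w₀.fst e))‖ := by congr 1; ring
    _ ≤ ‖extend φ (w i) - φ ((w i).fst e)‖ + ‖φ ((w i).fst e) - φ (w₀.fst e)‖
          + ‖extend φ w₀ - φ (w₀.fst e)‖ :=
        (norm_sub_le _ _).trans (add_le_add_left (norm_add_le _ _) _)
    _ < ε := by linarith

/-- The positive functional `a ↦ φ (v⋆ a v)` for a multiplier `v`. -/
noncomputable def conjPositive (φ : A →ₚ[ℂ] ℂ) (v : 𝓜(ℂ, A)) : A →ₚ[ℂ] ℂ :=
  PositiveLinearMap.mk₀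
    { toFun := fun a => extendPositive φ (star v * (a : 𝓜(ℂ, A)) * v)
      map_add' := fun a b => by rw [coe_add, mul_add, add_mul, map_add]
      map_smul' := fun r a => by
        have h : ((r • a : A) : 𝓜(ℂ, A)) = r • (a : 𝓜(ℂ, A)) :=
          map_smul (DoubleCentralizer.coeHom (𝕜 := ℂ) (A := A)) r a
        rw [h, mul_smul_comm, smul_mul_assoc, map_smul, RingHom.id_apply] }
    fun a ha => (extendPositive φ).map_nonneg (star_left_conjugate_nonneg (coe_nonneg ha) v)

lemma conjPositive_apply (φ : A →ₚ[ℂ] ℂ) (v : 𝓜(ℂ, A)) (a : A) :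
    conjPositive φ v a = extend φ (star v * (a : 𝓜(ℂ, A)) * v) := rfl

lemma extend_conjPositive (φ : A →ₚ[ℂ] ℂ) (v m : 𝓜(ℂ, A)) :
    extend (conjPositive φ v) m = extend φ (star v * m * v) := by
  refine tendsto_nhds_unique (tendsto_extend (conjPositive φ v) m) ?_
  simp only [conjPositive_apply]
  refine tendsto_extend_of_bounded φ (K := ‖star v‖ * ‖m‖ * ‖v‖) ?_ fun a => ?_
  · filter_upwards [(CStarAlgebra.increasingApproximateUnit A).eventually_norm] with e he
    refine (norm_mul_le _ _).trans (mul_le_mul_of_nonneg_right ((norm_mul_le _ _).trans ?_)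
      (norm_nonneg _))
    refine mul_le_mul_of_nonneg_left ?_ (norm_nonneg _)
    rw [norm_coe]
    exact (norm_fst_apply_le m e).trans (mul_le_of_le_one_right (norm_nonneg _) he)
  · have h1 : ∀ e : A, (star v * ((m.fst e : A) : 𝓜(ℂ, A)) * v).fst a
        = (star v * m).fst (e * v.fst a) := fun e => by
      rw [← mul_coe]
      simp
    have h2 : (star v * m * v).fst a = (star v * m).fst (v.fst a) := by simp
    simp only [h1, h2]
    exact ((star v * m).fst.continuous.tendsto _).comp
      ((CStarAlgebra.increasingApproximateUnit A).tendsto_mul_right (v.fst a))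

lemma extend_star (φ : A →ₚ[ℂ] ℂ) (m : 𝓜(ℂ, A)) : extend φ (star m) = star (extend φ m) :=
  map_star (extendPositive φ) m

lemma extend_sub (φ : A →ₚ[ℂ] ℂ) (m m' : 𝓜(ℂ, A)) :
    extend φ (m - m') = extend φ m - extend φ m' :=
  map_sub (extendPositive φ) m m'

lemma extend_mono (φ : A →ₚ[ℂ] ℂ) {m m' : 𝓜(ℂ, A)} (h : m ≤ m') : extend φ m ≤ extend φ m' :=
  OrderHomClass.mono (extendPositive φ) h

/-- A real functional that is positive on the positive cone is the restriction of a positive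
functional to the self-adjoint part. -/
lemma exists_positive_of_real (ψ : A →L[ℝ] ℝ) (hψ : ∀ p : A, 0 ≤ p → 0 ≤ ψ p) :
    ∃ φ : A →ₚ[ℂ] ℂ, ∀ p, IsSelfAdjoint p → φ p = (ψ p : ℂ) := by
  let ψ' : A →ₗ[ℝ] ℝ := (ψ : A →ₗ[ℝ] ℝ) ∘ₗ (selfAdjoint.submodule ℝ A).subtype ∘ₗ realPart
  have h' : ∀ p, ψ' p = ψ (realPart p : A) := fun p => rfl
  let F : A →ₗ[ℂ] ℂ := Module.Dual.extendRCLike ψ'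
  have hF : ∀ p, IsSelfAdjoint p → F p = (ψ p : ℂ) := fun p hp => by
    have h1 : F p = (ψ' p : ℂ) - Complex.I * (ψ' (Complex.I • p) : ℂ) :=
      Module.Dual.extendRCLike_apply ψ' p
    rw [h1, h', h', realPart_I_smul, hp.coe_realPart, hp.imaginaryPart]
    simp
  refine ⟨PositiveLinearMap.mk₀ F fun p hp => ?_, hF⟩
  rw [hF p (.of_nonneg hp)]
  exact_mod_cast hψ p hp

/-- The positive functionals detect positivity of self-adjoint elements. -/
lemma nonneg_of_forall_positive {p : A} (hp : IsSelfAdjoint p)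
    (h : ∀ φ : A →ₚ[ℂ] ℂ, 0 ≤ φ p) : 0 ≤ p := by
  by_contra hn
  have hconv : Convex ℝ {a : A | 0 ≤ a} := fun a ha b hb s t hs ht _ =>
    add_nonneg (smul_nonneg hs ha) (smul_nonneg ht hb)
  obtain ⟨ψ, u, hu1, hu2⟩ := geometric_hahn_banach_point_closed hconv
    CStarAlgebra.isClosed_nonneg hn
  have hu0 : u < 0 := by simpa using hu2 0 le_rfl
  have hψ : ∀ a : A, 0 ≤ a → 0 ≤ ψ a := by
    intro a ha
    by_contra hlt
    rw [not_le] at hlt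
    have h1 := hu2 ((u / ψ a) • a) (smul_nonneg (div_nonneg_of_nonpos hu0.le hlt.le) ha)
    simp only [map_smul, smul_eq_mul, div_mul_cancel₀ _ hlt.ne] at h1
    exact lt_irrefl _ h1
  obtain ⟨φ, hφ⟩ := exists_positive_of_real ψ hψ
  have h1 := h φ
  rw [hφ p hp] at h1
  have h2 : 0 ≤ ψ p := by exact_mod_cast h1
  linarith

lemma eq_zero_of_forall_positive {p : A} (hp : IsSelfAdjoint p)
    (h : ∀ φ : A →ₚ[ℂ] ℂ, φ p = 0) : p = 0 := by
  refine le_antisymm (neg_nonneg.mp ?_) (nonneg_of_forall_positive hp fun φ => (h φ).ge)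
  exact nonneg_of_forall_positive hp.neg fun φ => by rw [map_neg, h φ, neg_zero]

/-- A multiplier on which all positive functionals are positive is positive. -/
lemma nonneg_of_forall_extend {m : 𝓜(ℂ, A)} (h : ∀ φ : A →ₚ[ℂ] ℂ, 0 ≤ extend φ m) : 0 ≤ m := by
  have h1 : ∀ (φ : A →ₚ[ℂ] ℂ) (c : A), 0 ≤ φ (corner c m c) := fun φ c => by
    rw [← extend_coe, coe_corner, ← extend_conjPositive]
    exact h _
  refine nonneg_of_corner fun c => nonneg_of_forall_positive ?_ fun φ => h1 φ c
  have h2 : ∀ φ : A →ₚ[ℂ] ℂ, φ (star (corner c m c)) = φ (corner c m c) := fun φ => by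
    rw [map_star]
    exact (IsSelfAdjoint.of_nonneg (h1 φ c)).star_eq
  -- the skew part of the corner is `I` times a self-adjoint element
  have h3 : Complex.I • (star (corner c m c) - corner c m c) = 0 := by
    refine eq_zero_of_forall_positive ?_ fun φ => by rw [map_smul, map_sub, h2, sub_self, smul_zero]
    rw [IsSelfAdjoint, star_smul, star_sub, star_star, Complex.star_def, Complex.conj_I]
    module
  exact sub_eq_zero.mp ((smul_eq_zero.mp h3).resolve_left Complex.I_ne_zero)

lemma eq_of_forall_extend {m m' : 𝓜(ℂ, A)} (h : ∀ φ : A →ₚ[ℂ] ℂ, extend φ m = extend φ m') :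
    m = m' := by
  refine le_antisymm ?_ ?_ <;>
  refine sub_nonneg.mp (nonneg_of_forall_extend fun φ => ?_) <;>
  rw [extend_sub, h φ, sub_self]

/-- A noncommutative form of Dini's theorem: a decreasing family of positive elements tends to `0`
in norm if it does so under each positive functional. Otherwise the elements dominating a member
of the family form a convex set away from a ball, and a functional separating the two is positive
and bounded below on the family. -/
lemma exists_norm_lt_of_antitone {ι : Type*} [Preorder ι] [IsDirectedOrder ι] [Nonempty ι]
    {R : ι → A} (hR : Antitone R) (hR0 : ∀ i, 0 ≤ R i)
    (h : ∀ φ : A →ₚ[ℂ] ℂ, ∀ ε > 0, ∃ i, (φ (R i)).re < ε) {ε : ℝ} (hε : 0 < ε) :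
    ∃ i, ‖R i‖ < ε := by
  by_contra! hge
  let S : Set A := {v | ∃ i, R i ≤ v}
  have hconv : Convex ℝ S := by
    rintro v ⟨i, hi⟩ w ⟨j, hj⟩ s t hs ht hst
    obtain ⟨k, hik, hjk⟩ := exists_ge_ge i j
    refine ⟨k, ?_⟩
    calc R k = s • R k + t • R k := by rw [← add_smul, hst, one_smul]
      _ ≤ s • v + t • w := add_le_add (smul_le_smul_of_nonneg_left ((hR hik).trans hi) hs)
          (smul_le_smul_of_nonneg_left ((hR hjk).trans hj) ht)
  have hdisj : Disjoint (Metric.ball (0 : A) ε) S := by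
    rw [Set.disjoint_left]
    rintro v hv ⟨i, hi⟩
    have := CStarAlgebra.norm_le_norm_of_nonneg_of_le (hR0 i) hi
    rw [mem_ball_zero_iff] at hv
    linarith [hge i]
  obtain ⟨ψ, u, hu1, hu2⟩ := geometric_hahn_banach_open (convex_ball _ _)
    Metric.isOpen_ball hconv hdisj
  have hu0 : 0 < u := by simpa using hu1 0 (Metric.mem_ball_self hε)
  obtain ⟨i₀⟩ := ‹Nonempty ι›
  have hψ : ∀ a : A, 0 ≤ a → 0 ≤ ψ a := by
    intro a ha
    by_contra hlt
    rw [not_le] at hlt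
    have h0 : 0 ≤ ψ (R i₀) := hu0.le.trans (hu2 _ ⟨i₀, le_rfl⟩)
    have h1 := hu2 (R i₀ + (ψ (R i₀) / - ψ a) • a) ⟨i₀, le_add_of_nonneg_right
      (smul_nonneg (div_nonneg h0 (by linarith)) ha)⟩
    have h2 : ψ (R i₀) / - ψ a * ψ a = - ψ (R i₀) := by
      rw [div_neg, neg_mul, div_mul_cancel₀ _ hlt.ne]
    simp only [map_add, map_smul, smul_eq_mul, h2] at h1
    linarith
  obtain ⟨φ, hφ⟩ := exists_positive_of_real ψ hψ
  obtain ⟨i, hi⟩ := h φ u hu0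
  rw [hφ _ (.of_nonneg (hR0 i)), Complex.ofReal_re] at hi
  exact absurd (hu2 _ ⟨i, le_rfl⟩) (not_le.mpr hi)

end PositiveFunctional

/-! ### Measurability of fields -/

section Measurability

variable {T : Type*} [MeasurableSpace T] {μ : Measure T}

/-- Pettis' theorem in the separable case. Countably many functionals separate the points, so they
embed the space measurably into `ℕ → ℂ` by the Lusin-Souslin theorem. -/
lemma aestronglyMeasurable_of_dual {E : Type*} [NormedAddCommGroup E] [NormedSpace ℂ E]
    [CompleteSpace E] [TopologicalSpace.SeparableSpace E] {h : T → E}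
    (hh : ∀ ψ : StrongDual ℂ E, AEStronglyMeasurable (fun t => ψ (h t)) μ) :
    AEStronglyMeasurable h μ := by
  borelize E
  have : SecondCountableTopology E := UniformSpace.secondCountable_of_separable E
  have : PolishSpace E := inferInstance
  let p : ℕ → E := TopologicalSpace.denseSeq E
  choose ψ hψ1 hψ2 using fun k => exists_dual_vector'' ℂ (p k)
  let J : E → ℕ → ℂ := fun v k => ψ k v
  have hJc : Continuous J := continuous_pi fun k => (ψ k).continuous
  have hJi : Function.Injective J := by
    intro v w hvw
    by_contra hne
    have hpos : 0 < ‖v - w‖ / 2 := by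
      have := norm_pos_iff.mpr (sub_ne_zero.mpr hne)
      positivity
    obtain ⟨k, hk⟩ := (TopologicalSpace.denseRange_denseSeq E).exists_dist_lt (v - w) hpos
    rw [dist_eq_norm] at hk
    have h1 : ψ k (v - w) = 0 := by
      rw [map_sub]
      exact sub_eq_zero.mpr (congrFun hvw k)
    have h2 : ‖p k‖ ≤ ‖v - w - p k‖ := by
      calc ‖p k‖ = ‖ψ k (p k)‖ := by rw [hψ2]; simp
        _ = ‖ψ k (v - w - p k)‖ := by rw [map_sub, h1, zero_sub, norm_neg]
        _ ≤ 1 * ‖v - w - p k‖ := (ψ k).le_of_opNorm_le (hψ1 k) _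
        _ = _ := one_mul _
    have h3 : ‖v - w‖ ≤ ‖v - w - p k‖ + ‖p k‖ := by
      simpa using norm_add_le (v - w - p k) (p k)
    change ‖v - w - p k‖ < _ at hk
    linarith
  have hJ : MeasurableEmbedding J := hJc.measurableEmbedding hJi
  have hJh : AEMeasurable (J ∘ h) μ := aemeasurable_pi_iff.mpr fun k => (hh (ψ k)).aemeasurable
  exact (hJ.aemeasurable_comp_iff.mp hJh).aestronglyMeasurable

variable {A : Type*} [NonUnitalCStarAlgebra A] [PartialOrder A] [StarOrderedRing A]

lemma extend_comp_mul_right (ψ : StrongDual ℂ A) (c : A) (m : 𝓜(ℂ, A)) :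
    extend (ψ.comp ((ContinuousLinearMap.mul ℂ A).flip c)) m = ψ (m.fst c) := by
  refine Tendsto.limUnder_eq ?_
  have h1 : Tendsto (fun e : A => ψ (m.fst (e * c))) (CStarAlgebra.approximateUnit A)
      (𝓝 (ψ (m.fst c))) :=
    ((ψ.continuous.comp m.fst.continuous).tendsto _).comp
      ((CStarAlgebra.increasingApproximateUnit A).tendsto_mul_right c)
  refine h1.congr fun e => ?_
  simp [fst_mul]

variable (A) in
/-- A separable `C⋆`-algebra has a sequential left approximate unit. -/
lemma exists_seq_approximateUnit [TopologicalSpace.SeparableSpace A] :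
    ∃ g : ℕ → A, ∀ a, Tendsto (fun k => g k * a) atTop (𝓝 a) := by
  let p : ℕ → A := TopologicalSpace.denseSeq A
  have hex : ∀ k : ℕ, ∃ e : A, ‖e‖ ≤ 1 ∧ ∀ j ∈ Finset.range (k + 1),
      ‖e * p j - p j‖ < 1 / ((k : ℝ) + 1) := by
    intro k
    have hpos : (0 : ℝ) < 1 / ((k : ℝ) + 1) := by positivity
    have h1 : ∀ᶠ e in CStarAlgebra.approximateUnit A, ∀ j ∈ Finset.range (k + 1),
        ‖e * p j - p j‖ < 1 / ((k : ℝ) + 1) := by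
      rw [Filter.eventually_all_finset]
      intro j _
      have := Metric.tendsto_nhds.mp
        ((CStarAlgebra.increasingApproximateUnit A).tendsto_mul_right (p j)) _ hpos
      simpa [dist_eq_norm] using this
    exact ((CStarAlgebra.increasingApproximateUnit A).eventually_norm.and h1).exists
  choose g hg1 hg2 using hex
  refine ⟨g, fun a => Metric.tendsto_atTop.mpr fun ε hε => ?_⟩
  obtain ⟨j, hj⟩ := (TopologicalSpace.denseRange_denseSeq A).exists_dist_lt a
    (show 0 < ε / 3 by positivity)
  obtain ⟨N, hN⟩ := exists_nat_one_div_lt (show 0 < ε / 3 by positivity)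
  refine ⟨max N j, fun k hk => ?_⟩
  have hjk : j ∈ Finset.range (k + 1) := by
    have := (le_max_right N j).trans hk
    simp only [Finset.mem_range]
    omega
  have h1 := hg2 k j hjk
  have h2 : 1 / ((k : ℝ) + 1) ≤ 1 / ((N : ℝ) + 1) := by
    have : (N : ℝ) ≤ k := by exact_mod_cast (le_max_left N j).trans hk
    gcongr
  rw [dist_eq_norm] at hj ⊢
  change ‖a - p j‖ < _ at hj
  have h3 : ‖g k * (a - p j)‖ ≤ ‖a - p j‖ :=
    (norm_mul_le _ _).trans (mul_le_of_le_one_left (norm_nonneg _) (hg1 k))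
  calc ‖g k * a - a‖ = ‖g k * (a - p j) + (g k * p j - p j) - (a - p j)‖ := by
        rw [mul_sub]; congr 1; abel
    _ ≤ ‖g k * (a - p j)‖ + ‖g k * p j - p j‖ + ‖a - p j‖ :=
        (norm_sub_le _ _).trans (add_le_add_left (norm_add_le _ _) _)
    _ < ε := by linarith

variable [TopologicalSpace.SeparableSpace A]

lemma WeakStarMeasurable.fst {a : T → 𝓜(ℂ, A)} (ha : WeakStarMeasurable μ a) (c : A) :
    AEStronglyMeasurable (fun t => (a t).fst c) μ := by
  refine aestronglyMeasurable_of_dual fun ψ => ?_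
  simp only [← extend_comp_mul_right]
  exact ha _

/-- Weak* measurability of `a` gives strong measurability of the quadratic expression
`t ↦ a t⋆ x (a t) c`: apply a sequential approximate unit on the left. -/
lemma WeakStarMeasurable.conj_fst {a : T → 𝓜(ℂ, A)} (ha : WeakStarMeasurable μ a)
    (x : 𝓜(ℂ, A)) (c : A) :
    AEStronglyMeasurable (fun t => (star (a t) * x * a t).fst c) μ := by
  obtain ⟨g, hg⟩ := exists_seq_approximateUnit A
  refine aestronglyMeasurable_of_tendsto_ae atTop
    (f := fun k t => star ((a t).fst (star (g k))) * x.fst ((a t).fst c)) (fun k => ?_)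
    (Eventually.of_forall fun t => ?_)
  · have h1 : AEStronglyMeasurable (fun t => star ((a t).fst (star (g k)))) μ :=
      continuous_star.comp_aestronglyMeasurable (ha.fst _)
    exact h1.mul (x.fst.continuous.comp_aestronglyMeasurable (ha.fst c))
  · refine (hg ((star (a t) * x * a t).fst c)).congr fun k => ?_
    have := (star (a t)).central (g k) (x.fst ((a t).fst c))
    simpa using this.symm

omit [TopologicalSpace.SeparableSpace A] in
/-- A positive functional is a pointwise sequential limit of functionals `w ↦ φ (w e)`. -/
lemma exists_seq_tendsto_extend (φ : A →ₚ[ℂ] ℂ) :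
    ∃ g : ℕ → A, (∀ k, ‖g k‖ ≤ 1) ∧
      ∀ w : 𝓜(ℂ, A), Tendsto (fun k => φ (w.fst (g k))) atTop (𝓝 (extend φ w)) := by
  choose g _ hg1 hg using fun k : ℕ => exists_norm_extend_sub_le φ (ε := 1 / ((k : ℝ) + 1))
    (by positivity)
  refine ⟨g, hg1, fun w => tendsto_iff_norm_sub_tendsto_zero.mpr ?_⟩
  have h0 : Tendsto (fun k : ℕ => 1 / ((k : ℝ) + 1) * ‖w‖) atTop (𝓝 0) := by
    simpa using tendsto_one_div_add_atTop_nhds_zero_nat.mul_const ‖w‖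
  exact squeeze_zero (fun _ => norm_nonneg _) (fun k => by rw [norm_sub_rev]; exact hg k w) h0

omit [TopologicalSpace.SeparableSpace A] in
lemma aestronglyMeasurable_extend (φ : A →ₚ[ℂ] ℂ) {c : T → 𝓜(ℂ, A)}
    (hc : ∀ d, AEStronglyMeasurable (fun t => (c t).fst d) μ) :
    AEStronglyMeasurable (fun t => extend φ (c t)) μ := by
  obtain ⟨g, -, hg⟩ := exists_seq_tendsto_extend φ
  refine aestronglyMeasurable_of_tendsto_ae atTop (f := fun k t => φ ((c t).fst (g k)))
    (fun k => (map_continuous φ).comp_aestronglyMeasurable (hc _))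
    (Eventually.of_forall fun t => hg (c t))

lemma nullMeasurableSet_norm_le {a : T → 𝓜(ℂ, A)} (ha : WeakStarMeasurable μ a) {K : ℝ}
    (hK : 0 ≤ K) : NullMeasurableSet {t | ‖a t‖ ≤ K} μ := by
  let p : ℕ → A := TopologicalSpace.denseSeq A
  have h : {t | ‖a t‖ ≤ K} = ⋂ j, {t | ‖(a t).fst (p j)‖ ≤ K * ‖p j‖} := by
    ext t
    simp only [Set.mem_ofPred_eq, Set.mem_iInter]
    refine ⟨fun ht j => (norm_fst_apply_le _ _).trans (by gcongr), fun ht => ?_⟩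
    rw [← DoubleCentralizer.norm_fst]
    refine ContinuousLinearMap.opNorm_le_bound _ hK fun v => ?_
    have hcl : IsClosed {v : A | ‖(a t).fst v‖ ≤ K * ‖v‖} :=
      isClosed_le (by fun_prop) (by fun_prop)
    exact (TopologicalSpace.denseRange_denseSeq A).induction_on v hcl ht
  rw [h]
  exact NullMeasurableSet.iInter fun j =>
    nullMeasurableSet_le (ha.fst (p j)).norm.aemeasurable aemeasurable_const

end Measurability

/-! ### Weak integrals of fields -/

section Integral

variable {A : Type*} [NonUnitalCStarAlgebra A] [PartialOrder A] [StarOrderedRing A]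
  {T : Type*} [MeasurableSpace T] {μ : Measure T}

lemma IsFieldIntegral.unique {a : T → 𝓜(ℂ, A)} {y z : 𝓜(ℂ, A)} (hy : IsFieldIntegral μ a y)
    (hz : IsFieldIntegral μ a z) : y = z :=
  eq_of_forall_extend fun φ => (hy φ).2.trans (hz φ).2.symm

lemma FieldIntegrable.isFieldIntegral {a : T → 𝓜(ℂ, A)} (ha : FieldIntegrable μ a) :
    IsFieldIntegral μ a (fieldIntegral μ a) := by
  rw [fieldIntegral, dif_pos ha]
  exact ha.choose_spec

lemma IsFieldIntegral.fieldIntegral_eq {a : T → 𝓜(ℂ, A)} {y : 𝓜(ℂ, A)}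
    (hy : IsFieldIntegral μ a y) : fieldIntegral μ a = y :=
  (FieldIntegrable.isFieldIntegral ⟨y, hy⟩).unique hy

lemma IsFieldIntegral.add {a b : T → 𝓜(ℂ, A)} {y z : 𝓜(ℂ, A)} (hy : IsFieldIntegral μ a y)
    (hz : IsFieldIntegral μ b z) : IsFieldIntegral μ (fun t => a t + b t) (y + z) := fun φ => by
  simp only [extend_add]
  exact ⟨(hy φ).1.add (hz φ).1, by rw [integral_add (hy φ).1 (hz φ).1, (hy φ).2, (hz φ).2]⟩

lemma IsFieldIntegral.sub {a b : T → 𝓜(ℂ, A)} {y z : 𝓜(ℂ, A)} (hy : IsFieldIntegral μ a y)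
    (hz : IsFieldIntegral μ b z) : IsFieldIntegral μ (fun t => a t - b t) (y - z) := fun φ => by
  simp only [extend_sub]
  exact ⟨(hy φ).1.sub (hz φ).1, by rw [integral_sub (hy φ).1 (hz φ).1, (hy φ).2, (hz φ).2]⟩

lemma IsFieldIntegral.smul {a : T → 𝓜(ℂ, A)} {y : 𝓜(ℂ, A)} (hy : IsFieldIntegral μ a y)
    (r : ℂ) : IsFieldIntegral μ (fun t => r • a t) (r • y) := fun φ => by
  simp only [extend_smul]
  exact ⟨(hy φ).1.smul r, by rw [integral_smul, (hy φ).2]⟩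

lemma IsFieldIntegral.zero : IsFieldIntegral μ (fun _ : T => (0 : 𝓜(ℂ, A))) 0 := fun φ => by
  have h : extend φ (0 : 𝓜(ℂ, A)) = 0 := map_zero (extendPositive φ)
  simp [h]

lemma IsFieldIntegral.sum {ι : Type*} (s : Finset ι) {a : ι → T → 𝓜(ℂ, A)} {y : ι → 𝓜(ℂ, A)}
    (hy : ∀ i ∈ s, IsFieldIntegral μ (a i) (y i)) :
    IsFieldIntegral μ (fun t => ∑ i ∈ s, a i t) (∑ i ∈ s, y i) := by
  classical
  induction s using Finset.induction_on with
  | empty => simpa using IsFieldIntegral.zero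
  | insert i s hi ih =>
    simp only [Finset.sum_insert hi]
    exact (hy i (Finset.mem_insert_self _ _)).add
      (ih fun j hj => hy j (Finset.mem_insert_of_mem hj))

lemma IsFieldIntegral.nonneg {a : T → 𝓜(ℂ, A)} {y : 𝓜(ℂ, A)} (hy : IsFieldIntegral μ a y)
    (ha : ∀ t, 0 ≤ a t) : 0 ≤ y :=
  nonneg_of_forall_extend fun φ => by
    rw [(hy φ).2]
    exact integral_nonneg fun t => extend_nonneg φ (ha t)

lemma IsFieldIntegral.mono {a b : T → 𝓜(ℂ, A)} {y z : 𝓜(ℂ, A)} (hy : IsFieldIntegral μ a y)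
    (hz : IsFieldIntegral μ b z) (h : ∀ t, a t ≤ b t) : y ≤ z :=
  sub_nonneg.mp ((hz.sub hy).nonneg fun t => sub_nonneg.mpr (h t))

lemma IsFieldIntegral.isSelfAdjoint {a : T → 𝓜(ℂ, A)} {y : 𝓜(ℂ, A)}
    (hy : IsFieldIntegral μ a y) (ha : ∀ t, IsSelfAdjoint (a t)) : IsSelfAdjoint y := by
  refine eq_of_forall_extend fun φ => ?_
  have h : ∀ t, star (extend φ (a t)) = extend φ (a t) := fun t => by
    rw [← extend_star, (ha t).star_eq]
  rw [extend_star, (hy φ).2, Complex.star_def, ← integral_conj]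
  exact integral_congr_ae (Eventually.of_forall h)

/-- By polarization, the integral of a field can be tested on all functionals `φ (v⋆ · w)`. -/
lemma IsFieldIntegral.sesq {a : T → 𝓜(ℂ, A)} {y : 𝓜(ℂ, A)} (hy : IsFieldIntegral μ a y)
    (v w : 𝓜(ℂ, A)) : IsFieldIntegral μ (fun t => star v * a t * w) (star v * y * w) := by
  have hdiag : ∀ u : 𝓜(ℂ, A), IsFieldIntegral μ (fun t => star u * a t * u) (star u * y * u) :=
    fun u φ => by
      simp only [← extend_conjPositive]
      exact hy _
  have hpol : ∀ m : 𝓜(ℂ, A), star v * m * w = (1 / 2 : ℂ) • (star (v + w) * m * (v + w))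
      + (-(Complex.I / 2)) • (star (v + Complex.I • w) * m * (v + Complex.I • w))
      + (-(1 - Complex.I) / 2) • (star v * m * v) + (-(1 - Complex.I) / 2) • (star w * m * w) := by
    intro m
    simp only [star_add, star_smul, add_mul, mul_add, smul_mul_assoc, mul_smul_comm,
      Complex.star_def, Complex.conj_I, smul_add, smul_smul]
    have h1 : (-(Complex.I / 2) * Complex.I : ℂ) = 1 / 2 := by
      linear_combination (-1 / 2 : ℂ) * Complex.I_mul_I
    have h2 : (-(Complex.I / 2) * -Complex.I : ℂ) = - (1 / 2) := by
      linear_combination (1 / 2 : ℂ) * Complex.I_mul_I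
    have h3 : (-(Complex.I / 2) * (Complex.I * -Complex.I) : ℂ) = - (Complex.I / 2) := by
      linear_combination (Complex.I / 2) * Complex.I_mul_I
    simp only [h1, h2, h3]
    module
  simp only [hpol]
  exact ((((hdiag _).smul _).add ((hdiag _).smul _)).add ((hdiag _).smul _)).add ((hdiag _).smul _)

lemma IsFieldIntegral.mul_right {a : T → 𝓜(ℂ, A)} {y : 𝓜(ℂ, A)} (hy : IsFieldIntegral μ a y)
    (w : 𝓜(ℂ, A)) : IsFieldIntegral μ (fun t => a t * w) (y * w) := by
  simpa using hy.sesq 1 w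

lemma IsFieldIntegral.mul_left {a : T → 𝓜(ℂ, A)} {y : 𝓜(ℂ, A)} (hy : IsFieldIntegral μ a y)
    (w : 𝓜(ℂ, A)) : IsFieldIntegral μ (fun t => w * a t) (w * y) := by
  simpa using hy.sesq (star w) 1

lemma IsFieldIntegral.commute {a : T → 𝓜(ℂ, A)} {y : 𝓜(ℂ, A)} (hy : IsFieldIntegral μ a y)
    {w : 𝓜(ℂ, A)} (h : ∀ t, Commute (a t) w) : Commute y w := by
  have h1 := hy.mul_left w
  simp only [← (h _).eq] at h1
  exact (hy.mul_right w).unique h1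

lemma IsFieldIntegral.restrict_sdiff {a : T → 𝓜(ℂ, A)} {y z : 𝓜(ℂ, A)} {E F : Set T}
    (hE : MeasurableSet E) (hEF : E ⊆ F) (hy : IsFieldIntegral (μ.restrict E) a y)
    (hz : IsFieldIntegral (μ.restrict F) a z) :
    IsFieldIntegral (μ.restrict (F \ E)) a (z - y) := fun φ => by
  refine ⟨(hz φ).1.mono_measure (Measure.restrict_mono Set.sdiff_subset le_rfl), ?_⟩
  rw [extend_sub, (hz φ).2, (hy φ).2, ← setIntegral_sdiff hE (hz φ).1 hEF]

lemma IsFieldIntegral.restrict_compl {a : T → 𝓜(ℂ, A)} {y z : 𝓜(ℂ, A)} {E : Set T}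
    (hE : MeasurableSet E) (hy : IsFieldIntegral (μ.restrict E) a y)
    (hz : IsFieldIntegral μ a z) : IsFieldIntegral (μ.restrict Eᶜ) a (z - y) := by
  rw [Set.compl_eq_univ_sdiff]
  exact hy.restrict_sdiff hE (Set.subset_univ E) (by rwa [Measure.restrict_univ])

/-- A positive functional as a continuous linear map. -/
noncomputable def positiveCLM (φ : A →ₚ[ℂ] ℂ) : A →L[ℂ] ℂ := ⟨φ.toLinearMap, map_continuous φ⟩

/-- A bounded measurable field over a finite measure has an integral: integrate both actions on
`A` in the sense of Bochner. -/
lemma fieldIntegrable_of_bounded [IsFiniteMeasure μ] {c : T → 𝓜(ℂ, A)}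
    (h₁ : ∀ d, AEStronglyMeasurable (fun t => (c t).fst d) μ)
    (h₂ : ∀ d, AEStronglyMeasurable (fun t => (star (c t)).fst d) μ)
    {K : ℝ} (hK : ∀ᵐ t ∂μ, ‖c t‖ ≤ K) : FieldIntegrable μ c := by
  have h₂' : ∀ d, AEStronglyMeasurable (fun t => (c t).snd d) μ := fun d => by
    refine (continuous_star.comp_aestronglyMeasurable (h₂ (star d))).congr
      (Eventually.of_forall fun t => ?_)
    simp
  have hb₁ : ∀ d, ∀ᵐ t ∂μ, ‖(c t).fst d‖ ≤ K * ‖d‖ := fun d => by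
    filter_upwards [hK] with t ht
    exact (norm_fst_apply_le _ _).trans (by gcongr)
  have hb₂ : ∀ d, ∀ᵐ t ∂μ, ‖(c t).snd d‖ ≤ K * ‖d‖ := fun d => by
    filter_upwards [hK] with t ht
    refine ((c t).snd.le_opNorm d).trans ?_
    rw [DoubleCentralizer.norm_snd]
    gcongr
  have hi₁ : ∀ d, Integrable (fun t => (c t).fst d) μ := fun d => .of_bound (h₁ d) _ (hb₁ d)
  have hi₂ : ∀ d, Integrable (fun t => (c t).snd d) μ := fun d => .of_bound (h₂' d) _ (hb₂ d)
  let y : 𝓜(ℂ, A) :=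
    { fst := LinearMap.mkContinuous
        { toFun := fun d => ∫ t, (c t).fst d ∂μ
          map_add' := fun d e => by
            simp only [map_add]
            exact integral_add (hi₁ d) (hi₁ e)
          map_smul' := fun r d => by
            simp only [map_smul, RingHom.id_apply]
            exact integral_smul _ _ }
        (K * μ.real Set.univ) fun d => by
          refine (norm_integral_le_of_norm_le_const (hb₁ d)).trans_eq ?_
          ring
      snd := LinearMap.mkContinuous
        { toFun := fun d => ∫ t, (c t).snd d ∂μ
          map_add' := fun d e => by
            simp only [map_add]
            exact integral_add (hi₂ d) (hi₂ e)
          map_smul' := fun r d => by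
            simp only [map_smul, RingHom.id_apply]
            exact integral_smul _ _ }
        (K * μ.real Set.univ) fun d => by
          refine (norm_integral_le_of_norm_le_const (hb₂ d)).trans_eq ?_
          ring
      central := fun d e => by
        have h1 := ((ContinuousLinearMap.mul ℂ A).flip e).integral_comp_comm (hi₂ d)
        have h2 := (ContinuousLinearMap.mul ℂ A d).integral_comp_comm (hi₁ e)
        simp only [ContinuousLinearMap.flip_apply, ContinuousLinearMap.mul_apply'] at h1 h2
        simp only [LinearMap.mkContinuous_apply, LinearMap.coe_mk, AddHom.coe_mk]
        rw [← h1, ← h2]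
        simp only [(c _).central] }
  refine ⟨y, fun φ => ?_⟩
  obtain ⟨C, hC⟩ := (extendPositive φ).exists_norm_apply_le
  obtain ⟨D, hD⟩ := φ.exists_norm_apply_le
  have hm := aestronglyMeasurable_extend φ h₁
  refine ⟨.of_bound hm (C * K) ?_, ?_⟩
  · filter_upwards [hK] with t ht
    exact (hC (c t)).trans (by gcongr)
  obtain ⟨g, hg1, hg⟩ := exists_seq_tendsto_extend φ
  refine tendsto_nhds_unique (hg y) ?_
  have h1 : ∀ d, φ (y.fst d) = ∫ t, φ ((c t).fst d) ∂μ := fun d =>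
    ((positiveCLM φ).integral_comp_comm (hi₁ d)).symm
  simp only [h1]
  refine tendsto_integral_of_dominated_convergence (fun _ => D * K)
    (fun k => (map_continuous φ).comp_aestronglyMeasurable (h₁ _)) (integrable_const _)
    (fun k => ?_) (Eventually.of_forall fun t => hg (c t))
  filter_upwards [hK, hb₁ (g k)] with t ht ht'
  refine (hD _).trans (mul_le_mul_of_nonneg_left (ht'.trans ?_) D.2)
  exact mul_le_of_le_one_right ((norm_nonneg _).trans ht) (hg1 k)

omit [PartialOrder A] [StarOrderedRing A] in
lemma norm_sq_fst_le_of_nonneg {m : 𝓜(ℂ, A)} (hm : 0 ≤ m) (p : A) :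
    ‖m.fst p‖ ^ 2 ≤ ‖m‖ * ‖corner p m p‖ := by
  have hs := CFC.sqrt_nonneg m
  have hss : CFC.sqrt m * CFC.sqrt m = m := CFC.sqrt_mul_sqrt_self m
  have hst : star (CFC.sqrt m) = CFC.sqrt m := (IsSelfAdjoint.of_nonneg hs).star_eq
  generalize CFC.sqrt m = s at hs hss hst
  have h1 : ‖s‖ ^ 2 = ‖m‖ := by rw [← hss, sq, ← CStarRing.norm_star_mul_self, hst]
  have h2 : ‖s.fst p‖ ^ 2 = ‖corner p m p‖ := by
    rw [← norm_coe (corner p m p), coe_corner, ← hss, ← norm_coe, ← mul_coe, sq,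
      ← CStarRing.norm_star_mul_self, star_mul, hst]
    simp only [mul_assoc]
  have h3 : m.fst p = s.fst (s.fst p) := by
    rw [← hss]
    simp
  rw [h3, ← h1, ← h2, ← mul_pow]
  gcongr
  exact norm_fst_apply_le _ _

omit [PartialOrder A] [StarOrderedRing A] in
/-- Bounded strictly convergent families of self-adjoint multipliers have a limit. -/
lemma exists_strict_limit {ι : Type*} {l : Filter ι} [l.NeBot] {z : ι → 𝓜(ℂ, A)}
    (hsa : ∀ i, IsSelfAdjoint (z i)) {K : ℝ} (hK : ∀ i, ‖z i‖ ≤ K)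
    (h : ∀ p, ∃ q, Tendsto (fun i => (z i).fst p) l (𝓝 q)) :
    ∃ z₀ : 𝓜(ℂ, A), ∀ p, Tendsto (fun i => (z i).fst p) l (𝓝 (z₀.fst p)) := by
  choose f hf using h
  have hadd : ∀ p q, f (p + q) = f p + f q := fun p q =>
    tendsto_nhds_unique (hf (p + q)) (by simpa using (hf p).add (hf q))
  have hsmul : ∀ (r : ℂ) p, f (r • p) = r • f p := fun r p =>
    tendsto_nhds_unique (hf (r • p)) (by simpa using (hf p).const_smul r)
  have hb : ∀ p, ‖f p‖ ≤ K * ‖p‖ := fun p =>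
    le_of_tendsto (hf p).norm (Eventually.of_forall fun i =>
      (norm_fst_apply_le _ _).trans (mul_le_mul_of_nonneg_right (hK i) (norm_nonneg p)))
  refine ⟨{ fst := LinearMap.mkContinuous { toFun := f, map_add' := hadd, map_smul' := hsmul } K hb
            snd := LinearMap.mkContinuous
              { toFun := fun p => star (f (star p))
                map_add' := fun p q => by rw [star_add, hadd, star_add]
                map_smul' := fun r p => by rw [star_smul, hsmul, star_smul, star_star]; rfl }
              K fun p => by
                have := hb (star p)
                rw [norm_star] at this
                simpa using this
            central := fun p q => ?_ }, hf⟩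
  have h1 : Tendsto (fun i => star ((z i).fst (star p)) * q) l (𝓝 (star (f (star p)) * q)) :=
    ((continuous_star.tendsto _).comp (hf (star p))).mul_const q
  have h2 : Tendsto (fun i => p * (z i).fst q) l (𝓝 (p * f q)) := (hf q).const_mul p
  refine tendsto_nhds_unique h1 (h2.congr fun i => ?_)
  have h3 := (star (z i)).central p q
  rw [(hsa i).star_eq] at h3
  rw [← h3]
  nth_rw 1 [← (hsa i).star_eq]
  simp

/-- Dominated convergence for fields: if `0 ≤ c ≤ d`, if `d` is integrable, and if both fields are
integrable over the members of an exhausting directed family of sets, then `c` is integrable. The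
integrals `z E` of `c` over these sets form an increasing net in `M(A)`. The remainders of the
integral of `d` tend to `0` under every positive functional, hence strictly, so that the net `z` is
strictly Cauchy. -/
theorem fieldIntegrable_of_exhaustion {c d : T → 𝓜(ℂ, A)} (S : Set (Set T))
    (hmeas : ∀ E ∈ S, MeasurableSet E) (hun : ∀ E ∈ S, ∀ F ∈ S, E ∪ F ∈ S)
    (hex : ∀ g : T → ℝ, Integrable g μ → (∀ t, 0 ≤ g t) → ∀ ε > 0, ∃ E ∈ S, ∫ t in Eᶜ, g t ∂μ < ε)
    (hc0 : ∀ t, 0 ≤ c t) (hcd : ∀ t, c t ≤ d t)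
    (hcm : ∀ φ : A →ₚ[ℂ] ℂ, AEStronglyMeasurable (fun t => extend φ (c t)) μ)
    (hd : FieldIntegrable μ d) (hcE : ∀ E ∈ S, FieldIntegrable (μ.restrict E) c)
    (hdE : ∀ E ∈ S, FieldIntegrable (μ.restrict E) d) :
    FieldIntegrable μ c := by
  obtain ⟨b, hb⟩ := hd
  have hci : ∀ φ : A →ₚ[ℂ] ℂ, Integrable (fun t => extend φ (c t)) μ := fun φ => by
    refine (hb φ).1.mono (hcm φ) (Eventually.of_forall fun t => ?_)
    exact CStarAlgebra.norm_le_norm_of_nonneg_of_le (extend_nonneg φ (hc0 t))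
      (extend_mono φ (hcd t))
  let ι := {E : Set T // E ∈ S}
  have hne : Nonempty ι := by
    obtain ⟨E, hE, -⟩ := hex 0 (integrable_zero _ _ _) (fun _ => le_rfl) 1 one_pos
    exact ⟨⟨E, hE⟩⟩
  let _ : SemilatticeSup ι := Subtype.semilatticeSup fun {E F} hE hF => hun E hE F hF
  choose z hz using fun E : ι => hcE E.1 E.2
  choose bE hbE using fun E : ι => hdE E.1 E.2
  have hrem : ∀ E : ι, IsFieldIntegral (μ.restrict E.1ᶜ) d (b - bE E) := fun E =>
    (hbE E).restrict_compl (hmeas E.1 E.2) hb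
  have hd0 : ∀ t, 0 ≤ d t := fun t => (hc0 t).trans (hcd t)
  have hrem0 : ∀ E, 0 ≤ b - bE E := fun E => (hrem E).nonneg hd0
  -- each positive functional is small on a remainder
  have hsmall : ∀ (φ : A →ₚ[ℂ] ℂ) (ε : ℝ), 0 < ε → ∃ E : ι,
      ‖extend φ (b - bE E)‖ < ε ∧ ‖∫ t in E.1ᶜ, extend φ (c t) ∂μ‖ < ε := by
    intro φ ε hε
    obtain ⟨E, hE, hlt⟩ := hex (fun t => ‖extend φ (d t)‖) (hb φ).1.norm
      (fun t => norm_nonneg _) ε hε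
    refine ⟨⟨E, hE⟩, ?_, ?_⟩
    · rw [(hrem ⟨E, hE⟩ φ).2]
      exact (norm_integral_le_integral_norm _).trans_lt hlt
    · refine (norm_integral_le_of_norm_le (hb φ).1.norm.integrableOn
        (Eventually.of_forall fun t => ?_)).trans_lt hlt
      exact CStarAlgebra.norm_le_norm_of_nonneg_of_le (extend_nonneg φ (hc0 t))
        (extend_mono φ (hcd t))
  have hzd : ∀ E F : ι, E ≤ F → 0 ≤ z F - z E ∧ z F - z E ≤ b - bE E := by
    intro E F hEF
    have h1 := (hz E).restrict_sdiff (hmeas E.1 E.2) hEF (hz F)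
    have h2 := (hbE E).restrict_sdiff (hmeas E.1 E.2) hEF (hbE F)
    refine ⟨h1.nonneg hc0, (h1.mono h2 hcd).trans ?_⟩
    exact sub_le_sub_right (sub_nonneg.mp (hrem0 F)) _
  have hz0 : ∀ E, 0 ≤ z E := fun E => (hz E).nonneg hc0
  have hbE0 : ∀ E, 0 ≤ bE E := fun E => (hbE E).nonneg hd0
  have hzb : ∀ E, z E ≤ b := fun E =>
    ((hz E).mono (hbE E) hcd).trans (sub_nonneg.mp (hrem0 E))
  have hcorner : ∀ p : A, ∀ ε > 0, ∃ E : ι, ‖corner p (b - bE E) p‖ < ε := by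
    intro p ε hε
    refine exists_norm_lt_of_antitone (fun E F hEF => ?_) (fun E => corner_nonneg (hrem0 E) p)
      (fun φ δ hδ => ?_) hε
    · have h1 := (hbE E).restrict_sdiff (hmeas E.1 E.2) hEF (hbE F)
      have h2 := corner_nonneg (h1.nonneg hd0) p
      simp only [corner_sub] at h2 ⊢
      exact sub_le_sub_left (sub_nonneg.mp h2) _
    · obtain ⟨E, hE, -⟩ := hsmall (conjPositive φ p) δ hδ
      refine ⟨E, ?_⟩
      rw [extend_conjPositive, ← coe_corner, extend_coe] at hE
      exact (Complex.re_le_norm _).trans_lt hE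
  have hdiff : ∀ (p : A) (E F : ι), E ≤ F →
      ‖(z F).fst p - (z E).fst p‖ ^ 2 ≤ ‖b‖ * ‖corner p (b - bE E) p‖ := by
    intro p E F hEF
    obtain ⟨h1, h2⟩ := hzd E F hEF
    have h3 := norm_sq_fst_le_of_nonneg h1 p
    rw [DoubleCentralizer.sub_fst, sub_apply] at h3
    refine h3.trans (mul_le_mul ?_ ?_ (norm_nonneg _) (norm_nonneg _))
    · exact CStarAlgebra.norm_le_norm_of_nonneg_of_le h1
        ((sub_le_self _ (hz0 E)).trans (hzb F))
    · refine CStarAlgebra.norm_le_norm_of_nonneg_of_le (corner_nonneg h1 p) ?_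
      have h4 := corner_nonneg (sub_nonneg.mpr h2) p
      rw [corner_sub] at h4
      exact sub_nonneg.mp h4
  obtain ⟨y, hy⟩ : ∃ y : 𝓜(ℂ, A), ∀ p, Tendsto (fun E => (z E).fst p) atTop (𝓝 (y.fst p)) := by
    refine exists_strict_limit (K := ‖b‖) (fun E => .of_nonneg (hz0 E))
      (fun E => CStarAlgebra.norm_le_norm_of_nonneg_of_le (hz0 E) (hzb E)) fun p => ?_
    refine cauchySeq_tendsto_of_complete (Metric.cauchySeq_iff'.mpr fun ε hε => ?_)
    obtain ⟨E, hE⟩ := hcorner p (ε ^ 2 / (‖b‖ + 1)) (by positivity)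
    refine ⟨E, fun F hF => ?_⟩
    rw [dist_eq_norm]
    refine lt_of_pow_lt_pow_left₀ 2 hε.le ((hdiff p E F hF).trans_lt ?_)
    calc ‖b‖ * ‖corner p (b - bE E) p‖ ≤ (‖b‖ + 1) * ‖corner p (b - bE E) p‖ := by
          gcongr; linarith
      _ < (‖b‖ + 1) * (ε ^ 2 / (‖b‖ + 1)) := by gcongr
      _ = ε ^ 2 := by field_simp
  have hyc : ∀ p, Tendsto (fun E => corner p (z E) p) atTop (𝓝 (corner p y p)) := fun p =>
    (hy p).const_mul (star p)
  have hyz : ∀ E, 0 ≤ y - z E ∧ y - z E ≤ b - bE E := by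
    intro E
    constructor
    · refine nonneg_of_corner fun p => ?_
      rw [corner_sub, sub_nonneg]
      refine ge_of_tendsto (hyc p) ?_
      filter_upwards [eventually_ge_atTop E] with F hF
      have h1 := corner_nonneg (hzd E F hF).1 p
      rw [corner_sub] at h1
      exact sub_nonneg.mp h1
    · rw [← sub_nonneg]
      refine nonneg_of_corner fun p => ?_
      have h2 : corner p (b - bE E - (y - z E)) p
          = corner p (b - bE E + z E) p - corner p y p := by
        simp only [corner_sub, corner_add]
        abel
      rw [h2, sub_nonneg]
      refine le_of_tendsto (hyc p) ?_
      filter_upwards [eventually_ge_atTop E] with F hF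
      have h1 := corner_nonneg (sub_nonneg.mpr (hzd E F hF).2) p
      have h3 : corner p (b - bE E - (z F - z E)) p
          = corner p (b - bE E + z E) p - corner p (z F) p := by
        simp only [corner_sub, corner_add]
        abel
      rw [h3] at h1
      exact sub_nonneg.mp h1
  refine ⟨y, fun φ => ⟨hci φ, ?_⟩⟩
  refine eq_of_forall_dist_le fun ε hε => ?_
  obtain ⟨E, hE1, hE2⟩ := hsmall φ (ε / 2) (by positivity)
  have h1 : ‖extend φ (y - z E)‖ ≤ ‖extend φ (b - bE E)‖ :=
    CStarAlgebra.norm_le_norm_of_nonneg_of_le (extend_nonneg φ (hyz E).1)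
      (extend_mono φ (hyz E).2)
  have h2 := integral_add_compl (hmeas E.1 E.2) (hci φ)
  rw [dist_eq_norm, ← h2, ← (hz E φ).2, ← sub_sub, ← extend_sub]
  exact (norm_sub_le _ _).trans (by linarith)

end Integral

section Conjugation

variable {A : Type*} [NonUnitalCStarAlgebra A] [PartialOrder A] [StarOrderedRing A]
  [TopologicalSpace.SeparableSpace A] {T : Type*} [MeasurableSpace T] {μ : Measure T}

/-- The measurable sets of finite measure on which the field `a` is essentially bounded. -/
def boundedSets (μ : Measure T) (a : T → 𝓜(ℂ, A)) : Set (Set T) :=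
  {E | MeasurableSet E ∧ μ E < ⊤ ∧ ∃ K : ℝ, ∀ᵐ t ∂μ.restrict E, ‖a t‖ ≤ K}

omit [PartialOrder A] [StarOrderedRing A] [TopologicalSpace.SeparableSpace A] in
lemma union_mem_boundedSets {a : T → 𝓜(ℂ, A)} {E F : Set T} (hE : E ∈ boundedSets μ a)
    (hF : F ∈ boundedSets μ a) : E ∪ F ∈ boundedSets μ a := by
  obtain ⟨hE1, hE2, K, hK⟩ := hE
  obtain ⟨hF1, hF2, L, hL⟩ := hF
  refine ⟨hE1.union hF1, measure_union_lt_top hE2 hF2, max K L, ?_⟩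
  rw [ae_restrict_union_iff]
  exact ⟨hK.mono fun t ht => ht.trans (le_max_left _ _),
    hL.mono fun t ht => ht.trans (le_max_right _ _)⟩

/-- Every integrable function lives, up to `ε`, on a set from `boundedSets μ a`: use the sets where
`‖a‖ ≤ k` and the function is at least `1 / (k + 1)`. In particular, `μ` need not be `σ`-finite. -/
lemma exists_mem_boundedSets {a : T → 𝓜(ℂ, A)} (ha : WeakStarMeasurable μ a) {g : T → ℝ}
    (hg : Integrable g μ) {ε : ℝ} (hε : 0 < ε) :
    ∃ E ∈ boundedSets μ a, ∫ t in Eᶜ, g t ∂μ < ε := by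
  choose F hFsub hFm hFae using fun k : ℕ =>
    (nullMeasurableSet_norm_le ha (Nat.cast_nonneg k)).exists_measurable_subset_ae_eq
  let g' : T → ℝ := hg.1.mk g
  have hg'm : StronglyMeasurable g' := hg.1.stronglyMeasurable_mk
  have hgg' : g =ᵐ[μ] g' := hg.1.ae_eq_mk
  have hg' : Integrable g' μ := hg.congr hgg'
  let E : ℕ → Set T := fun k => F k ∩ {t | 1 / ((k : ℝ) + 1) ≤ ‖g' t‖}
  have hEm : ∀ k, MeasurableSet (E k) := fun k =>
    (hFm k).inter (measurableSet_le measurable_const hg'm.norm.measurable)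
  have hEmem : ∀ k, E k ∈ boundedSets μ a := fun k => by
    refine ⟨hEm k, ?_, k, ?_⟩
    · exact (measure_mono Set.inter_subset_right).trans_lt
        (hg'.measure_norm_ge_lt_top (by positivity))
    · exact ae_restrict_of_forall_mem (hEm k) fun t ht => hFsub k ht.1
  have hlim : Tendsto (fun k => ∫ t in (E k)ᶜ, g t ∂μ) atTop (𝓝 0) := by
    have h0 : ∫ _ : T, (0 : ℝ) ∂μ = 0 := integral_zero _ _
    rw [← h0]
    simp only [← integral_indicator (hEm _).compl]
    refine tendsto_integral_of_dominated_convergence (fun t => ‖g t‖)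
      (fun k => hg.1.indicator (hEm k).compl) hg.norm
      (fun k => Eventually.of_forall fun t => norm_indicator_le_norm_self _ _) ?_
    filter_upwards [hgg', ae_all_iff.mpr fun k => (hFae k).mem_iff] with t ht hF
    refine tendsto_const_nhds.congr' ?_
    rcases eq_or_ne (g t) 0 with h | h
    · exact Eventually.of_forall fun k => (by simp [Set.indicator, h])
    · have hpos : 0 < ‖g' t‖ := by rw [← ht]; exact norm_pos_iff.mpr h
      obtain ⟨N, hN⟩ := exists_nat_one_div_lt hpos
      obtain ⟨M, hM⟩ := exists_nat_ge ‖a t‖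
      filter_upwards [eventually_ge_atTop (max N M)] with k hk
      have hN' : (N : ℝ) ≤ k := by exact_mod_cast (le_max_left N M).trans hk
      have hM' : (M : ℝ) ≤ k := by exact_mod_cast (le_max_right N M).trans hk
      have hmem : t ∈ E k := by
        refine ⟨(hF k).mpr (hM.trans hM'), le_trans ?_ hN.le⟩
        gcongr
      exact (Set.indicator_of_notMem (Set.notMem_compl_iff.mpr hmem) _).symm
  obtain ⟨k, hk⟩ := (hlim.eventually_lt_const hε).exists
  exact ⟨E k, hEmem k, hk⟩

lemma conj_le_norm_smul {M : Type*} [CStarAlgebra M] [PartialOrder M] [StarOrderedRing M]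
    (x a : M) (hx : IsSelfAdjoint x) : star a * x * a ≤ (‖x‖ : ℂ) • (star a * a) := by
  have := CStarAlgebra.star_left_conjugate_le_norm_smul (a := a) (b := x) hx
  simpa using this

/-- If `(a t⋆ a t)` is integrable, then so is `(a t⋆ x a t)` for each self-adjoint multiplier. -/
theorem fieldIntegrable_conj {a : T → 𝓜(ℂ, A)} (ha : WeakStarMeasurable μ a)
    (hint : FieldIntegrable μ fun t => star (a t) * a t) {x : 𝓜(ℂ, A)} (hx : IsSelfAdjoint x) :
    FieldIntegrable μ fun t => star (a t) * x * a t := by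
  have key : ∀ w : 𝓜(ℂ, A), 0 ≤ w → FieldIntegrable μ fun t => star (a t) * w * a t := by
    intro w hw
    have hbd : ∀ E ∈ boundedSets μ a, ∀ v : 𝓜(ℂ, A),
        FieldIntegrable (μ.restrict E) fun t => star (a t) * v * a t := by
      rintro E ⟨-, hE, K, hK⟩ v
      have : IsFiniteMeasure (μ.restrict E) := ⟨by rwa [Measure.restrict_apply_univ]⟩
      refine fieldIntegrable_of_bounded (K := |K| * ‖v‖ * |K|) (fun d => (ha.conj_fst v d).restrict)
        (fun d => ?_) ?_
      · refine ((ha.conj_fst (star v) d).restrict (s := E)).congr (Eventually.of_forall fun t => ?_)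
        simp only [star_mul, star_star, mul_assoc]
      · filter_upwards [hK] with t ht
        have ht' : ‖a t‖ ≤ |K| := ht.trans (le_abs_self K)
        refine (norm_mul_le _ _).trans (mul_le_mul ((norm_mul_le _ _).trans ?_) ht'
          (norm_nonneg _) (by positivity))
        rw [norm_star]
        gcongr
    obtain ⟨b, hb⟩ := hint
    have hdE : ∀ E ∈ boundedSets μ a,
        FieldIntegrable (μ.restrict E) fun t => (‖w‖ : ℂ) • (star (a t) * a t) := by
      intro E hE
      obtain ⟨z, hz⟩ := hbd E hE 1
      simp only [mul_one] at hz
      exact ⟨_, hz.smul _⟩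
    exact fieldIntegrable_of_exhaustion (boundedSets μ a) (fun E hE => hE.1)
      (fun E hE F hF => union_mem_boundedSets hE hF)
      (fun g hg _ ε hε => exists_mem_boundedSets ha hg hε)
      (fun t => star_left_conjugate_nonneg hw _)
      (fun t => conj_le_norm_smul w (a t) (.of_nonneg hw))
      (fun φ => aestronglyMeasurable_extend φ fun d => ha.conj_fst w d) ⟨_, hb.smul _⟩
      (fun E hE => hbd E hE w) hdE
  obtain ⟨z₁, h₁⟩ := key _ (CFC.posPart_nonneg x)
  obtain ⟨z₂, h₂⟩ := key _ (CFC.negPart_nonneg x)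
  refine ⟨z₁ - z₂, ?_⟩
  have := h₁.sub h₂
  simpa only [← sub_mul, ← mul_sub, CFC.posPart_sub_negPart x] using this

end Conjugation

/-! ### The joint calculus of real functions -/

section RealCalculus

variable {M : Type*} [CStarAlgebra M] {n : ℕ}

/-- The coordinate function `λ ↦ λᵢ`, as a real function on the product of the spectra. -/
noncomputable def realCoord (x : Fin n → M) (i : Fin n) : C(spectralBox x, ℝ) :=
  ⟨fun l => l.1 i, (continuous_apply i).comp continuous_subtype_val⟩

/-- A joint calculus, restricted to real continuous functions on the product of the spectra. -/
structure IsRealCalculus (x : Fin n → M) (Ψ : C(spectralBox x, ℝ) →ₐ[ℝ] M) : Prop where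
  apply_coord : ∀ i, Ψ (realCoord x i) = x i
  isSelfAdjoint : ∀ g, IsSelfAdjoint (Ψ g)
  apply_restrict : ∀ f (hf : ContinuousOn f (spectralBox x)),
    jointCFC f x = Ψ ⟨fun l => f l.1, continuousOn_iff_continuous_domRestrict.mp hf⟩
  mem_of_isClosed : ∀ S : StarSubalgebra ℂ M, IsClosed (S : Set M) → (∀ i, x i ∈ S) → ∀ g, Ψ g ∈ S

lemma exists_isRealCalculus (x : Fin n → M) (hx : IsAbelianTuple x) :
    ∃ Ψ, IsRealCalculus x Ψ := by
  have hex := exists_isJointCalculus x hx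
  have hΦ := hex.choose_spec
  set Φ := hex.choose with hΦdef
  let κ : C(spectralBox x, ℝ) →ₐ[ℝ] C(spectralBox x, ℂ) :=
    Complex.ofRealAm.compLeftContinuous ℝ Complex.continuous_ofReal
  refine ⟨((Φ : C(spectralBox x, ℂ) →ₐ[ℂ] M).restrictScalars ℝ).comp κ, ⟨hΦ, fun g => ?_,
    fun f hf => ?_, fun S hS hxS g => ?_⟩⟩
  · have h : star (κ g) = κ g := by
      ext l
      exact Complex.conj_ofReal _
    change star (Φ (κ g)) = Φ (κ g)
    rw [← map_star, h]
  · rw [jointCFC, dif_pos ⟨hex, hf⟩]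
    rfl
  · have htop : (StarAlgebra.adjoin ℂ (Set.range (boxCoord x))).topologicalClosure = ⊤ := by
      apply ContinuousMap.starSubalgebra_topologicalClosure_eq_top_of_separatesPoints
      intro p q hpq
      have : ∃ i, p.1 i ≠ q.1 i := by
        by_contra! h
        exact hpq (Subtype.ext (funext h))
      obtain ⟨i, hi⟩ := this
      refine ⟨_, ⟨boxCoord x i, StarAlgebra.subset_adjoin ℂ _ ⟨i, rfl⟩, rfl⟩, ?_⟩
      simpa [boxCoord] using hi
    have hle : (⊤ : StarSubalgebra ℂ C(spectralBox x, ℂ)) ≤ S.comap Φ := by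
      rw [← htop]
      refine StarSubalgebra.topologicalClosure_minimal (StarAlgebra.adjoin_le ?_)
        (hS.preimage (NonUnitalStarAlgHom.instContinuousLinearMapClassComplex.map_continuous Φ))
      rintro _ ⟨i, rfl⟩
      change Φ (boxCoord x i) ∈ S
      rw [hΦ i]
      exact hxS i
    exact hle (StarSubalgebra.mem_top (x := κ g))

variable {x : Fin n → M} {Ψ : C(spectralBox x, ℝ) →ₐ[ℝ] M}

lemma isSelfAdjoint_jointCFC (hx : IsAbelianTuple x) (f : (Fin n → ℝ) → ℝ) :
    IsSelfAdjoint (jointCFC f x) := by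
  by_cases hf : ContinuousOn f (spectralBox x)
  · obtain ⟨Ψ, hΨ⟩ := exists_isRealCalculus x hx
    rw [hΨ.apply_restrict f hf]
    exact hΨ.isSelfAdjoint _
  · rw [jointCFC, dif_neg fun h => hf h.2]
    exact .zero _

lemma IsRealCalculus.apply_affine (hΨ : IsRealCalculus x Ψ) (k : Fin n → ℝ) (c : ℝ) :
    Ψ (∑ i, k i • realCoord x i + c • 1) = ∑ i, k i • x i + c • 1 := by
  simp [map_sum, hΨ.apply_coord]

lemma affine_apply (k : Fin n → ℝ) (c : ℝ) (l : spectralBox x) :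
    (∑ i, k i • realCoord x i + c • 1 : C(spectralBox x, ℝ)) l = ∑ i, k i * l.1 i + c := by
  simp [realCoord, ContinuousMap.sum_apply]

variable [PartialOrder M] [StarOrderedRing M]

lemma exists_sq_eq {X : Type*} [TopologicalSpace X] {g : C(X, ℝ)} (hg : 0 ≤ g) :
    ∃ r : C(X, ℝ), r * r = g :=
  ⟨⟨fun l => √(g l), Real.continuous_sqrt.comp g.continuous⟩,
    ContinuousMap.ext fun l => Real.mul_self_sqrt (hg l)⟩

lemma IsRealCalculus.mono (hΨ : IsRealCalculus x Ψ) {g h : C(spectralBox x, ℝ)} (hgh : g ≤ h) :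
    Ψ g ≤ Ψ h := by
  obtain ⟨r, hr⟩ := exists_sq_eq (sub_nonneg.mpr hgh)
  rw [← sub_nonneg, ← map_sub, ← hr, map_mul]
  nth_rw 1 [← (hΨ.isSelfAdjoint r).star_eq]
  exact star_mul_self_nonneg _

lemma affine_le_jointCFC (hx : IsAbelianTuple x) {f : (Fin n → ℝ) → ℝ}
    (hf : ContinuousOn f (spectralBox x)) {k : Fin n → ℝ} {c : ℝ}
    (h : ∀ l ∈ spectralBox x, ∑ i, k i * l i + c ≤ f l) :
    ∑ i, k i • x i + c • 1 ≤ jointCFC f x := by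
  obtain ⟨Ψ, hΨ⟩ := exists_isRealCalculus x hx
  rw [hΨ.apply_restrict f hf, ← hΨ.apply_affine]
  exact hΨ.mono fun l => (affine_apply k c l).trans_le (h l.1 l.2)

end RealCalculus

/-! ### Jensen's trace inequality -/

section Jensen

variable {M : Type*} [CStarAlgebra M] [PartialOrder M] [StarOrderedRing M] {n : ℕ}

/-- The elements `y` with `φ (m y) = φ (y m)` for all `m` form a closed subalgebra. -/
noncomputable def centralizerSubalgebra (φ : M →ₚ[ℂ] ℂ) : StarSubalgebra ℂ M where
  carrier := {y | ∀ m, φ (m * y) = φ (y * m)}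
  mul_mem' {y z} hy hz m := by rw [← mul_assoc, hz, ← mul_assoc, hy, mul_assoc]
  add_mem' {y z} hy hz m := by rw [mul_add, map_add, hy, hz, add_mul, map_add]
  algebraMap_mem' r m := by rw [Algebra.commutes r m]
  star_mem' {y} hy m := by
    have h : ∀ a b : M, φ (a * star b) = star (φ (b * star a)) := fun a b => by
      rw [← map_star, star_mul, star_star]
    have h' : ∀ a b : M, φ (star b * a) = star (φ (star a * b)) := fun a b => by
      rw [← map_star, star_mul, star_star]
    rw [h, h', hy]

lemma isClosed_centralizerSubalgebra (φ : M →ₚ[ℂ] ℂ) :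
    IsClosed (centralizerSubalgebra φ : Set M) := by
  have h : (centralizerSubalgebra φ : Set M) = ⋂ m, {y | φ (m * y) = φ (y * m)} := by
    ext y
    simp only [Set.mem_iInter]
    exact Iff.rfl
  rw [h]
  refine isClosed_iInter fun m => isClosed_eq ?_ ?_
  · exact (map_continuous φ).comp (continuous_const_mul m)
  · exact (map_continuous φ).comp (continuous_mul_const m)

/-- A convex function on a compact set is, up to `ε`, the supremum of finitely many affine
minorants. Consequently there is a partition of unity `p` with `f ≤ ∑ p (affine) + ε`. -/
lemma exists_partition_affine {K Y : Set (Fin n → ℝ)} (hK : IsClosed K) {f : (Fin n → ℝ) → ℝ}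
    (hconv : ConvexOn ℝ K f) (hcont : ContinuousOn f K) (hY : Y ⊆ K) [CompactSpace Y]
    {ε : ℝ} (hε : 0 < ε) :
    ∃ (s : Finset Y) (k : Y → Fin n → ℝ) (c : Y → ℝ) (p : Y → C(Y, ℝ)),
      (∀ v, ∀ l ∈ K, ∑ i, k v i * l i + c v ≤ f l) ∧ (∀ v, 0 ≤ p v) ∧ ∑ v ∈ s, p v = 1 ∧
      ∀ l : Y, f l ≤ ∑ v ∈ s, p v l * (∑ i, k v i * l.1 i + c v) + ε := by
  have hex : ∀ v : Y, ∃ (k : Fin n → ℝ) (c : ℝ), (∀ l ∈ K, ∑ i, k i * l i + c ≤ f l) ∧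
      ∑ i, k i * v.1 i + c = f v - ε / 2 := by
    intro v
    obtain ⟨L, c, h1, h2⟩ := ConvexOn.exists_affine_le_of_lt (𝕜 := ℝ) (x := v.1) (a := f v - ε / 2)
      (hY v.2) (by linarith) hK hcont.lowerSemicontinuousOn hconv
    have hL : ∀ l, L l = ∑ i, L (fun j => if i = j then 1 else 0) * l i := fun l => by
      rw [← ContinuousLinearMap.coe_coe, LinearMap.pi_apply_eq_sum_univ]
      simp [mul_comm]
    refine ⟨fun i => L (fun j => if i = j then 1 else 0), c, fun l hl => ?_, ?_⟩
    · rw [← hL]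
      simpa using h1 ⟨l, hl⟩
    · rw [← hL]
      simpa using h2
  choose k c hkle hkeq using hex
  have hfc : Continuous fun l : Y => f l.1 :=
    continuousOn_iff_continuous_domRestrict.mp (hcont.mono hY)
  have hac : ∀ v, Continuous fun l : Y => ∑ i, k v i * l.1 i + c v := fun v =>
    (continuous_finsetSum _ fun i _ => continuous_const.mul
      ((continuous_apply i).comp continuous_subtype_val)).add continuous_const
  obtain ⟨s, hs⟩ := CompactSpace.elim_nhds_subcover
    (fun v : Y => {l : Y | f l.1 - ε < ∑ i, k v i * l.1 i + c v}) fun v =>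
      (isOpen_lt (hfc.sub continuous_const) (hac v)).mem_nhds (by
        change f v.1 - ε < _
        rw [hkeq]
        linarith)
  let h : Y → C(Y, ℝ) := fun v =>
    ⟨fun l => max 0 (∑ i, k v i * l.1 i + c v - f l.1 + ε),
      continuous_const.max (((hac v).sub hfc).add continuous_const)⟩
  have hh0 : ∀ v l, 0 ≤ h v l := fun v l => le_max_left _ _
  have hH : ∀ l, 0 < ∑ v ∈ s, h v l := fun l => by
    have hl : l ∈ ⋃ v ∈ s, {l : Y | f l.1 - ε < ∑ i, k v i * l.1 i + c v} := by
      rw [hs]; trivial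
    simp only [Set.mem_iUnion] at hl
    obtain ⟨v, hv, hlt⟩ := hl
    have hlt' : f l.1 - ε < ∑ i, k v i * l.1 i + c v := hlt
    exact Finset.sum_pos' (fun w _ => hh0 w l) ⟨v, hv, lt_max_of_lt_right (by linarith)⟩
  let p : Y → C(Y, ℝ) := fun v =>
    ⟨fun l => h v l / ∑ w ∈ s, h w l, (h v).continuous.div
      (continuous_finsetSum _ fun w _ => (h w).continuous) fun l => (hH l).ne'⟩
  have hp1 : ∀ l, ∑ v ∈ s, p v l = 1 := fun l => by
    change ∑ v ∈ s, h v l / ∑ w ∈ s, h w l = 1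
    rw [← Finset.sum_div, div_self (hH l).ne']
  refine ⟨s, k, c, p, hkle, fun v l => div_nonneg (hh0 v l) (hH l).le, ?_, fun l => ?_⟩
  · ext l
    simpa [ContinuousMap.sum_apply] using hp1 l
  · have hterm : ∀ v ∈ s, p v l * (f l.1 - ε) ≤ p v l * (∑ i, k v i * l.1 i + c v) := by
      intro v _
      rcases le_or_gt (∑ i, k v i * l.1 i + c v - f l.1 + ε) 0 with hle | hgt
      · have h0 : p v l = 0 := by
          change h v l / _ = 0
          have : h v l = 0 := max_eq_left hle
          rw [this, zero_div]
        rw [h0, zero_mul, zero_mul]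
      · exact mul_le_mul_of_nonneg_left (by linarith) (div_nonneg (hh0 v l) (hH l).le)
    have hsum := Finset.sum_le_sum hterm
    rw [← Finset.sum_mul, hp1, one_mul] at hsum
    linarith

/-- Jensen's trace inequality in abstract form: if `Z` dominates `ℓ(y)` for each affine minorant
`ℓ` of the convex function `f`, then `φ (f(y)) ≤ φ Z` for each positive functional `φ` that is
tracial with respect to the `yᵢ`. Cut `f` with a partition of unity `p` such that
`f ≤ ∑ p ℓ + ε`, and use that `φ (p(y) ℓ(y)) ≤ φ (p(y) Z)`. -/
theorem apply_jointCFC_le {y : Fin n → M} (hy : IsAbelianTuple y) (φ : M →ₚ[ℂ] ℂ)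
    (hφ : ∀ i, y i ∈ centralizerSubalgebra φ) {K : Set (Fin n → ℝ)} (hK : IsClosed K)
    (hyK : spectralBox y ⊆ K) {f : (Fin n → ℝ) → ℝ} (hconv : ConvexOn ℝ K f)
    (hcont : ContinuousOn f K) {Z : M}
    (hZ : ∀ (k : Fin n → ℝ) (c : ℝ), (∀ l ∈ K, ∑ i, k i * l i + c ≤ f l) →
      ∑ i, k i • y i + c • 1 ≤ Z) :
    φ (jointCFC f y) ≤ φ Z := by
  obtain ⟨Ψ, hΨ⟩ := exists_isRealCalculus y hy
  have hfY := hcont.mono hyK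
  have hcen : ∀ g m, φ (m * Ψ g) = φ (Ψ g * m) := fun g =>
    hΨ.mem_of_isClosed _ (isClosed_centralizerSubalgebra φ) hφ g
  have key : ∀ ε : ℝ, 0 < ε → φ (jointCFC f y) ≤ φ Z + (ε : ℂ) * φ 1 := by
    intro ε hε
    obtain ⟨s, k, c, p, hle, hp0, hp1, hf⟩ := exists_partition_affine hK hconv hcont hyK hε
    let ℓ : spectralBox y → C(spectralBox y, ℝ) := fun v =>
      ∑ i, k v i • realCoord y i + c v • 1
    have h1 : jointCFC f y ≤ ∑ v ∈ s, Ψ (p v) * Ψ (ℓ v) + ε • 1 := by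
      have h2 : ∑ v ∈ s, Ψ (p v) * Ψ (ℓ v) + ε • 1 = Ψ (∑ v ∈ s, p v * ℓ v + ε • 1) := by
        simp [map_sum]
      rw [h2, hΨ.apply_restrict f hfY]
      refine hΨ.mono fun l => ?_
      have h3 := hf l
      simpa [ContinuousMap.sum_apply, ℓ, realCoord] using h3
    have h4 : ∀ v, φ (Ψ (p v) * Ψ (ℓ v)) ≤ φ (Ψ (p v) * Z) := by
      intro v
      have hD : 0 ≤ Z - Ψ (ℓ v) := by
        rw [sub_nonneg, hΨ.apply_affine]
        exact hZ _ _ (hle v)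
      obtain ⟨r, hr⟩ := exists_sq_eq (hp0 v)
      rw [← sub_nonneg, ← map_sub, ← mul_sub, ← hr, map_mul Ψ, mul_assoc, ← hcen]
      have h5 := star_left_conjugate_nonneg hD (Ψ r)
      rw [(hΨ.isSelfAdjoint r).star_eq] at h5
      exact φ.map_nonneg h5
    have h6 : φ Z = ∑ v ∈ s, φ (Ψ (p v) * Z) := by
      rw [← map_sum, ← Finset.sum_mul, ← map_sum, hp1, map_one, one_mul]
    calc φ (jointCFC f y) ≤ φ (∑ v ∈ s, Ψ (p v) * Ψ (ℓ v) + ε • 1) := OrderHomClass.mono φ h1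
      _ = ∑ v ∈ s, φ (Ψ (p v) * Ψ (ℓ v)) + (ε : ℂ) * φ 1 := by
        rw [map_add, map_sum, φ.map_smul_of_tower, Complex.real_smul]
      _ ≤ ∑ v ∈ s, φ (Ψ (p v) * Z) + (ε : ℂ) * φ 1 := by
        exact add_le_add (Finset.sum_le_sum fun v _ => h4 v) le_rfl
      _ = _ := by rw [← h6]
  have hlim : Tendsto (fun ε : ℝ => φ Z + (ε : ℂ) * φ 1) (𝓝[>] 0) (𝓝 (φ Z)) := by
    have : Continuous fun ε : ℝ => φ Z + (ε : ℂ) * φ 1 := by fun_prop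
    simpa using (this.tendsto 0).mono_left nhdsWithin_le_nhds
  refine ge_of_tendsto hlim ?_
  filter_upwards [self_mem_nhdsWithin] with ε hε using key ε hε

end Jensen

/-! ### Column fields in commuting subalgebras -/

section Multipliers

variable {A : Type*} [NonUnitalCStarAlgebra A] {B C : NonUnitalStarSubalgebra ℂ A}

lemma commute_coe_of_mem_multipliers (h : ∀ c ∈ B, ∀ d ∈ C, c * d = d * c) {m : 𝓜(ℂ, A)}
    (hm : m ∈ multipliers B) {d : A} (hd : d ∈ C) : Commute m (d : 𝓜(ℂ, A)) :=
  hm.2 _ fun c hc => by rw [← coe_mul_eq, ← coe_mul_eq, h c hc d hd]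

lemma commute_of_mem_multipliers (h : ∀ c ∈ B, ∀ d ∈ C, c * d = d * c) {m k : 𝓜(ℂ, A)}
    (hm : m ∈ multipliers B) (hk : k ∈ multipliers C) : Commute m k :=
  hm.2 _ fun _ hc =>
    (commute_coe_of_mem_multipliers (fun d hd e he => (h e he d hd).symm) hk hc).eq

lemma commute_star_of_mem_multipliers (h : ∀ c ∈ B, ∀ d ∈ C, c * d = d * c) {m k : 𝓜(ℂ, A)}
    (hm : m ∈ multipliers B) (hk : k ∈ multipliers C) : Commute m (star k) :=
  hm.2 _ fun _ hc => by
    have h1 := commute_coe_of_mem_multipliers (fun d hd e he => (h e he d hd).symm) hk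
      (star_mem hc)
    have h2 := h1.star_star
    rw [coe_star, star_star] at h2
    exact h2.eq

end Multipliers

section Columns

variable {A : Type*} [NonUnitalCStarAlgebra A] [PartialOrder A] [StarOrderedRing A]
  {T : Type*} [MeasurableSpace T] {μ : Measure T} {n : ℕ}

/-- `e` is the integral of `h` along the column fields `a₁, …, aₙ`, that is, the value at `h` of the
completely positive map `h ↦ ∑ⱼ ∫ aⱼₜ⋆ h aⱼₜ dμ(t)`. -/
def IsColumnIntegral (μ : Measure T) (a : Fin n → T → 𝓜(ℂ, A)) (h e : 𝓜(ℂ, A)) : Prop :=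
  IsFieldIntegral μ (fun t => ∑ j, star (a j t) * h * a j t) e

variable {a : Fin n → T → 𝓜(ℂ, A)} {h h' e e' : 𝓜(ℂ, A)}

lemma IsColumnIntegral.add (H : IsColumnIntegral μ a h e) (H' : IsColumnIntegral μ a h' e') :
    IsColumnIntegral μ a (h + h') (e + e') := by
  have := IsFieldIntegral.add H H'
  simpa only [IsColumnIntegral, mul_add, add_mul, Finset.sum_add_distrib] using this

lemma IsColumnIntegral.smul (H : IsColumnIntegral μ a h e) (r : ℝ) :
    IsColumnIntegral μ a (r • h) (r • e) := by
  have := IsFieldIntegral.smul H (r : ℂ)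
  simpa only [IsColumnIntegral, Finset.smul_sum, Complex.coe_smul, mul_smul_comm,
    smul_mul_assoc] using this

lemma IsColumnIntegral.sum {ι : Type*} (s : Finset ι) {h e : ι → 𝓜(ℂ, A)}
    (H : ∀ i ∈ s, IsColumnIntegral μ a (h i) (e i)) :
    IsColumnIntegral μ a (∑ i ∈ s, h i) (∑ i ∈ s, e i) := by
  have := IsFieldIntegral.sum s H
  simp only [IsColumnIntegral, Finset.mul_sum, Finset.sum_mul]
  simp only [Finset.sum_comm (s := s)] at this
  exact this

lemma IsColumnIntegral.mono (H : IsColumnIntegral μ a h e) (H' : IsColumnIntegral μ a h' e')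
    (hle : h ≤ h') : e ≤ e' :=
  IsFieldIntegral.mono H H' fun _ =>
    Finset.sum_le_sum fun _ _ => star_left_conjugate_le_conjugate hle _

end Columns

lemma spectrum_subset_Icc {M : Type*} [CStarAlgebra M] [PartialOrder M] [StarOrderedRing M]
    {y : M} (hy : IsSelfAdjoint y) {α β : ℝ} (h1 : α • 1 ≤ y) (h2 : y ≤ β • 1) :
    spectrum ℝ y ⊆ Set.Icc α β := by
  rw [← Algebra.algebraMap_eq_smul_one] at h1 h2
  exact fun s hs => ⟨(algebraMap_le_iff_le_spectrum hy).mp h1 s hs,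
    (le_algebraMap_iff_spectrum_le hy).mp h2 s hs⟩

lemma exists_bounds_of_spectrum_subset {M : Type*} [CStarAlgebra M] [PartialOrder M]
    [StarOrderedRing M] [Nontrivial M] {x : M} (hx : IsSelfAdjoint x) {I : Set ℝ}
    (hI : I.OrdConnected) (hxI : spectrum ℝ x ⊆ I) :
    ∃ α β : ℝ, Set.Icc α β ⊆ I ∧ spectrum ℝ x ⊆ Set.Icc α β ∧ α • 1 ≤ x ∧ x ≤ β • 1 := by
  have hne : (spectrum ℝ x).Nonempty :=
    ContinuousFunctionalCalculus.spectrum_nonempty x hx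
  obtain ⟨α, hα, hα'⟩ := (spectrum.isCompact (𝕜 := ℝ) x).exists_isLeast hne
  obtain ⟨β, hβ, hβ'⟩ := (spectrum.isCompact (𝕜 := ℝ) x).exists_isGreatest hne
  refine ⟨α, β, hI.out (hxI hα) (hxI hβ), fun s hs => ⟨hα' hs, hβ' hs⟩, ?_, ?_⟩ <;>
  rw [← Algebra.algebraMap_eq_smul_one]
  · exact algebraMap_le_of_le_spectrum (fun s hs => hα' hs) hx
  · exact le_algebraMap_of_spectrum_le (fun s hs => hβ' hs) hx

section Centralizer

variable {A : Type*} [NonUnitalCStarAlgebra A] [PartialOrder A] [StarOrderedRing A]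

lemma coe_mem_centralizerSubalgebra {φ : A →ₚ[ℂ] ℂ} {c : A} (hc : c ∈ centralizer φ) :
    (c : 𝓜(ℂ, A)) ∈ centralizerSubalgebra (extendPositive φ) := by
  intro m
  rw [extendPositive_apply, extendPositive_apply, mul_coe, extend_coe]
  refine tendsto_nhds_unique ?_ (tendsto_extend φ ((c : 𝓜(ℂ, A)) * m))
  have h1 : Tendsto (fun e : A => φ (m.fst (e * c))) (CStarAlgebra.approximateUnit A)
      (𝓝 (φ (m.fst c))) :=
    (((map_continuous φ).comp m.fst.continuous).tendsto _).comp
      ((CStarAlgebra.increasingApproximateUnit A).tendsto_mul_right c)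
  refine h1.congr fun e => ?_
  rw [fst_mul, hc (m.fst e)]
  simp

end Centralizer

end TraceJensen

open TraceJensen in
theorem corollary14
    {A : Type*} [NonUnitalCStarAlgebra A] [PartialOrder A] [StarOrderedRing A]
    [TopologicalSpace.SeparableSpace A]
    {T : Type*} [MetricSpace T] [LocallyCompactSpace T] [MeasurableSpace T] [BorelSpace T]
    (μ : Measure T) [μ.Regular]
    {n : ℕ}
    -- mutually commuting C⋆-subalgebras
    (B : Fin n → NonUnitalStarSubalgebra ℂ A) (hB : ∀ i, IsClosed (B i : Set A))
    (hBcomm : ∀ i j, i ≠ j → ∀ c ∈ B i, ∀ d ∈ B j, c * d = d * c)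
    -- a convex continuous function on a cube
    (I : Fin n → Set ℝ) (hI : ∀ i, (I i).OrdConnected)
    (f : (Fin n → ℝ) → ℝ) (hfconv : ConvexOn ℝ (Set.univ.pi I) f)
    (hfcont : ContinuousOn f (Set.univ.pi I))
    -- the elements `x i`
    (x : Fin n → A) (hxB : ∀ i, x i ∈ B i) (hxsa : ∀ i, IsSelfAdjoint (x i))
    (hxI : ∀ i, spectrum ℝ (x i : 𝓜(ℂ, A)) ⊆ I i)
    -- the column fields
    (a : Fin n → T → 𝓜(ℂ, A)) (ha : ∀ i t, a i t ∈ multipliers (B i))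
    (ha_meas : ∀ i, WeakStarMeasurable μ (a i))
    (ha_int : ∀ i, FieldIntegrable μ fun t => star (a i t) * a i t)
    (b : Fin n → 𝓜(ℂ, A)) (hb : ∀ i, b i = fieldIntegral μ fun t => star (a i t) * a i t)
    (hb_sum : ∑ i, b i = 1)
    (y : Fin n → 𝓜(ℂ, A))
    (hy : ∀ i, y i = (fieldIntegral μ fun t => star (a i t) * (x i : 𝓜(ℂ, A)) * a i t) +
      (1 - b i) * (x i : 𝓜(ℂ, A))) :
    -- all expressions in the inequality are meaningful
    (∀ i, FieldIntegrable μ fun t => star (a i t) * (x i : 𝓜(ℂ, A)) * a i t) ∧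
    (∀ i, FieldIntegrable μ fun t =>
      star (a i t) * jointCFC f (fun j => (x j : 𝓜(ℂ, A))) * a i t) ∧
    IsAbelianTuple y ∧ (∀ i, spectrum ℝ (y i) ⊆ I i) ∧
    -- the inequality
    ∀ φ : A →ₚ[ℂ] ℂ, (∀ i, ∃ c ∈ centralizer φ, (c : 𝓜(ℂ, A)) = y i) →
      extend φ (jointCFC f y) ≤
        extend φ (∑ i, fieldIntegral μ fun t =>
          star (a i t) * jointCFC f (fun j => (x j : 𝓜(ℂ, A))) * a i t) := by
  have hXsa : ∀ i, IsSelfAdjoint (x i : 𝓜(ℂ, A)) := fun i => by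
    rw [IsSelfAdjoint, ← coe_star, (hxsa i).star_eq]
  have hX : IsAbelianTuple fun j => (x j : 𝓜(ℂ, A)) := by
    refine ⟨hXsa, fun i j => ?_⟩
    rcases eq_or_ne i j with rfl | hij
    · exact Commute.refl _
    · change (x i : 𝓜(ℂ, A)) * (x j : 𝓜(ℂ, A)) = (x j : 𝓜(ℂ, A)) * (x i : 𝓜(ℂ, A))
      rw [← coe_mul_eq, ← coe_mul_eq, hBcomm i j hij _ (hxB i) _ (hxB j)]
  have hint : ∀ i {w : 𝓜(ℂ, A)}, IsSelfAdjoint w →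
      FieldIntegrable μ fun t => star (a i t) * w * a i t := fun i w hw =>
    fieldIntegrable_conj (ha_meas i) (ha_int i) hw
  have hbint : ∀ i, IsFieldIntegral μ (fun t => star (a i t) * a i t) (b i) := fun i => by
    rw [hb i]
    exact (ha_int i).isFieldIntegral
  obtain ⟨z, hz⟩ : ∃ z : Fin n → 𝓜(ℂ, A), ∀ i,
      IsFieldIntegral μ (fun t => star (a i t) * (x i : 𝓜(ℂ, A)) * a i t) (z i) :=
    ⟨_, fun i => (hint i (hXsa i)).isFieldIntegral⟩
  have hyz : ∀ i, y i = z i + (1 - b i) * (x i : 𝓜(ℂ, A)) := fun i => by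
    rw [hy i, (hz i).fieldIntegral_eq]
  -- everything with index `i` commutes with everything with index `j ≠ i`
  have hax : ∀ i j, i ≠ j → ∀ t, Commute (a i t) (x j : 𝓜(ℂ, A)) := fun i j hij t =>
    commute_coe_of_mem_multipliers (hBcomm i j hij) (ha i t) (hxB j)
  have hasx : ∀ i j, i ≠ j → ∀ t, Commute (star (a i t)) (x j : 𝓜(ℂ, A)) := fun i j hij t => by
    have h1 := (hax i j hij t).star_star
    rwa [(hXsa j).star_eq] at h1
  have haa : ∀ i j, i ≠ j → ∀ s t, Commute (a i s) (a j t) := fun i j hij s t =>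
    commute_of_mem_multipliers (hBcomm i j hij) (ha i s) (ha j t)
  have haas : ∀ i j, i ≠ j → ∀ s t, Commute (a i s) (star (a j t)) := fun i j hij s t =>
    commute_star_of_mem_multipliers (hBcomm i j hij) (ha i s) (ha j t)
  have hcomm : ∀ i (w : 𝓜(ℂ, A)), (∀ t, Commute (a i t) w) → (∀ t, Commute (star (a i t)) w) →
      Commute (x i : 𝓜(ℂ, A)) w → Commute (b i) w ∧ Commute (z i) w := fun i w h1 h2 h3 =>
    ⟨(hbint i).commute fun t => (h2 t).mul_left (h1 t),
      (hz i).commute fun t => ((h2 t).mul_left h3).mul_left (h1 t)⟩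
  have hbzx : ∀ i j, i ≠ j → Commute (b i) (x j : 𝓜(ℂ, A)) ∧ Commute (z i) (x j : 𝓜(ℂ, A)) :=
    fun i j hij => hcomm i _ (hax i j hij) (hasx i j hij) (hX.2 i j)
  have hbza : ∀ i j, i ≠ j → ∀ t, (Commute (b i) (a j t) ∧ Commute (z i) (a j t)) ∧
      (Commute (b i) (star (a j t)) ∧ Commute (z i) (star (a j t))) := fun i j hij t =>
    ⟨hcomm i _ (fun s => haa i j hij s t) (fun s => (haas j i hij.symm t s).symm)
        (hax j i hij.symm t).symm,
      hcomm i _ (fun s => haas i j hij s t) (fun s => (haa i j hij s t).star_star)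
        (hasx j i hij.symm t).symm⟩
  have hbz : ∀ i j, i ≠ j → (Commute (b i) (b j) ∧ Commute (b i) (z j)) ∧
      (Commute (z i) (b j) ∧ Commute (z i) (z j)) := fun i j hij => by
    have h1 := hcomm j (b i) (fun t => (hbza i j hij t).1.1.symm)
      (fun t => (hbza i j hij t).2.1.symm) (hbzx i j hij).1.symm
    have h2 := hcomm j (z i) (fun t => (hbza i j hij t).1.2.symm)
      (fun t => (hbza i j hij t).2.2.symm) (hbzx i j hij).2.symm
    exact ⟨⟨h1.1.symm, h1.2.symm⟩, ⟨h2.1.symm, h2.2.symm⟩⟩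
  have hb_compl : ∀ i, 1 - b i = ∑ j ∈ Finset.univ.erase i, b j := fun i => by
    rw [← hb_sum, ← Finset.add_sum_erase _ _ (Finset.mem_univ i), add_sub_cancel_left]
  -- `1 - b i` is a sum of terms with an index other than `i`
  have hbx : ∀ i, Commute (1 - b i) (x i : 𝓜(ℂ, A)) := fun i => by
    rw [hb_compl]
    exact Commute.sum_left _ _ _ fun j hj => (hbzx j i (Finset.ne_of_mem_erase hj)).1
  have hysa : ∀ i, IsSelfAdjoint (y i) := fun i => by
    have h1 : IsSelfAdjoint (z i) := (hz i).isSelfAdjoint fun t => (hXsa i).conjugate' _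
    have h2 : IsSelfAdjoint (b i) :=
      (hbint i).isSelfAdjoint fun t => IsSelfAdjoint.star_mul_self _
    rw [hyz]
    refine h1.add ?_
    rw [IsSelfAdjoint, star_mul, star_sub, star_one, h2.star_eq, (hXsa i).star_eq, (hbx i).eq]
  have hyab : IsAbelianTuple y := by
    refine ⟨hysa, fun i j => ?_⟩
    rcases eq_or_ne i j with rfl | hij
    · exact Commute.refl _
    obtain ⟨⟨h1, h2⟩, h3, h4⟩ := hbz i j hij
    have hz1 : Commute (z i) (1 - b j) := (Commute.one_right _).sub_right h3
    have hb1 : Commute (1 - b i) (1 - b j) :=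
      (Commute.one_left _).sub_left ((Commute.one_right _).sub_right h1)
    have hb2 : Commute (1 - b i) (z j) := (Commute.one_left _).sub_left h2
    have hb3 : Commute (1 - b i) (x j : 𝓜(ℂ, A)) :=
      (Commute.one_left _).sub_left (hbzx i j hij).1
    have hx1 : Commute (x i : 𝓜(ℂ, A)) (1 - b j) :=
      (Commute.one_right _).sub_right (hbzx j i hij.symm).1.symm
    have hx2 : Commute (x i : 𝓜(ℂ, A)) (z j) := (hbzx j i hij.symm).2.symm
    rw [hyz i, hyz j]
    exact (h4.add_right (hz1.mul_right (hbzx i j hij).2)).add_left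
      ((hb2.mul_left hx2).add_right ((hb1.mul_left hx1).mul_right (hb3.mul_left (hX.2 i j))))
  -- the columns form a unital column, and `y i` is the integral of `x i` along it
  have hcol1 : IsColumnIntegral μ a 1 1 := by
    have h1 := IsFieldIntegral.sum Finset.univ fun i _ => hbint i
    rw [hb_sum] at h1
    simpa only [IsColumnIntegral, mul_one] using h1
  have hcolx : ∀ i, IsColumnIntegral μ a (x i : 𝓜(ℂ, A)) (y i) := fun i => by
    have h1 : y i = ∑ j, if j = i then z i else b j * (x i : 𝓜(ℂ, A)) := by
      rw [hyz, hb_compl, Finset.sum_mul, ← Finset.add_sum_erase _ _ (Finset.mem_univ i),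
        if_pos rfl]
      congr 1
      exact Finset.sum_congr rfl fun j hj => (if_neg (Finset.ne_of_mem_erase hj)).symm
    rw [h1]
    refine IsFieldIntegral.sum _ fun j _ => ?_
    rcases eq_or_ne j i with rfl | hji
    · rw [if_pos rfl]
      exact hz j
    · rw [if_neg hji]
      have h2 : ∀ t, star (a j t) * (x i : 𝓜(ℂ, A)) * a j t
          = star (a j t) * a j t * (x i : 𝓜(ℂ, A)) := fun t => by
        rw [mul_assoc, mul_assoc, (hax j i hji t).eq]
      simp only [h2]
      exact (hbint j).mul_right _
  have hyIcc : ∀ i {α β : ℝ}, α • 1 ≤ (x i : 𝓜(ℂ, A)) → (x i : 𝓜(ℂ, A)) ≤ β • 1 →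
      spectrum ℝ (y i) ⊆ Set.Icc α β := fun i α β h1 h2 =>
    spectrum_subset_Icc (hysa i) ((hcol1.smul α).mono (hcolx i) h1)
      ((hcolx i).mono (hcol1.smul β) h2)
  refine ⟨fun i => hint i (hXsa i), fun i => hint i (isSelfAdjoint_jointCFC hX f), hyab,
    fun i => ?_, fun φ hφ => ?_⟩
  · rcases subsingleton_or_nontrivial 𝓜(ℂ, A) with hs | hs
    · rw [spectrum.of_subsingleton]
      exact Set.empty_subset _
    · obtain ⟨α, β, h1, -, h2, h3⟩ := exists_bounds_of_spectrum_subset (hXsa i) (hI i) (hxI i)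
      exact (hyIcc i h2 h3).trans h1
  · rcases subsingleton_or_nontrivial 𝓜(ℂ, A) with hs | hs
    · exact (congrArg (extend φ) (Subsingleton.elim _ _)).le
    choose α β h1 h2 h3 h4 using fun i =>
      exists_bounds_of_spectrum_subset (hXsa i) (hI i) (hxI i)
    let K : Set (Fin n → ℝ) := Set.univ.pi fun i => Set.Icc (α i) (β i)
    have hKI : K ⊆ Set.univ.pi I := Set.pi_mono fun i _ => h1 i
    have hxK : spectralBox (fun j => (x j : 𝓜(ℂ, A))) ⊆ K := Set.pi_mono fun i _ => h2 i
    have hyK : spectralBox y ⊆ K := Set.pi_mono fun i _ => hyIcc i (h3 i) (h4 i)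
    have hKc : Convex ℝ K := convex_pi fun i _ => convex_Icc _ _
    have hcolf : IsColumnIntegral μ a (jointCFC f fun j => (x j : 𝓜(ℂ, A)))
        (∑ i, fieldIntegral μ fun t =>
          star (a i t) * jointCFC f (fun j => (x j : 𝓜(ℂ, A))) * a i t) :=
      IsFieldIntegral.sum _ fun i _ => (hint i (isSelfAdjoint_jointCFC hX f)).isFieldIntegral
    refine apply_jointCFC_le hyab (extendPositive φ) (fun i => ?_)
      (isClosed_set_pi fun i _ => isClosed_Icc) hyK (hfconv.subset hKI hKc) (hfcont.mono hKI)
      fun k c hkc => ?_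
    · obtain ⟨d, hd, hdy⟩ := hφ i
      rw [← hdy]
      exact coe_mem_centralizerSubalgebra hd
    · refine IsColumnIntegral.mono ((IsColumnIntegral.sum _ fun i _ => (hcolx i).smul (k i)).add
        (hcol1.smul c)) hcolf ?_
      exact affine_le_jointCFC hX (hfcont.mono (hxK.trans hKI)) fun l hl => hkc l (hxK hl)
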